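/- Let $d$ be a positive integer. For $n\ge 1$ let $M_n^d$ be the space of $d$-tuples of complex $n\times n$ matrices with the metric $d(X,Y)=\|X-Y\|$ given by the row norm $\|X\|=\bigl\|\sum_{i=1}^d X_iX_i^*\bigr\|^{1/2}$ (operator norm on the right), and let $d_H$ be the induced Hausdorff distance $$d_H(E,F)=\max\Bigl\{\sup_{x\in E}\inf_{y\in F}d(x,y),\ \sup_{y\in F}\inf_{x\in E}d(x,y)\Bigr\}$$ between subsets of $M_n^d$. For a $d$-tuple $a=(a_1,\dots,a_d)$ of bounded operators on a complex Hilbert space $\mathcal H$, the $n$-th level of its matrix range is $$\mathcal W_n(a)=\bigl\{(\phi(a_1),\dots,\phi(a_d)) : \phi\colon B(\mathcal H)\to M_n(\mathbb C)\ \text{unital completely positive}\bigr\}\subseteq M_n^d .$$ Let $\mathbb C\langle z,z^*\rangle$ be the algebra of $*$-polynomials in $d$ noncommuting variables $z_1,\dots,z_d$; for $p$ in it, $p(a)$ is obtained by substituting $a_i$ for $z_i$ and $a_i^*$ for $z_i^*$. Let $T^N=(T^N_1,\dots,T^N_d)$, $N=1,2,\dots$, be $d$-tuples of random complex $N\times N$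 matrices, all defined on one probability space and regarded as operators on $\mathbb C^N$, and let $t=(t_1,\dots,t_d)$ be a $d$-tuple of bounded operators on a complex Hilbert space. Suppose that for every $p\in\mathbb C\langle z,z^*\rangle$, almost surely, $$\lim_{N\to\infty}\|p(T^N)\|=\|p(t)\| .$$ Then, almost surely, for every $n\ge 1$, $$\lim_{N\to\infty} d_H\bigl(\mathcal W_n(T^N),\mathcal W_n(t)\bigr)=0 .$$ -/

import Mathlib

open Filter Topology MeasureTheory
open scoped Matrix.Norms.L2Operator MatrixOrder CStarAlgebra

/-- `*`-polynomials `ℂ⟨z, z*⟩` in `d` noncommuting variables: the free complex algebra on the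
letters `z_1, …, z_d` (`Sum.inl`) and `z_1*, …, z_d*` (`Sum.inr`). -/
abbrev StarPoly (d : ℕ) : Type := FreeAlgebra ℂ (Fin d ⊕ Fin d)

/-- The value `p(a)` of a `*`-polynomial at a tuple of bounded operators on a Hilbert space:
`z_i` is replaced by `a_i`, and `z_i*` by the adjoint of `a_i`. -/
noncomputable def StarPoly.eval {d : ℕ} {H : Type*} [NormedAddCommGroup H]
    [InnerProductSpace ℂ H] [CompleteSpace H] (a : Fin d → (H →L[ℂ] H)) (p : StarPoly d) :
    H →L[ℂ] H :=
  FreeAlgebra.lift ℂ (Sum.elim a (fun i => ContinuousLinearMap.adjoint (a i))) p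

/-- A `d`-tuple of complex `N × N` matrices, seen as a tuple of operators on the Hilbert
space `ℂ^N`. -/
noncomputable def tupleOp {d N : ℕ} (X : Fin d → Matrix (Fin N) (Fin N) ℂ) :
    Fin d → (EuclideanSpace ℂ (Fin N) →L[ℂ] EuclideanSpace ℂ (Fin N)) :=
  fun i => Matrix.toEuclideanCLM (n := Fin N) (𝕜 := ℂ) (X i)

/-- The space `M_n^d` of `d`-tuples of complex `n × n` matrices, as a type of its own: it is normed
by the row norm below, not by the maximum of the norms of the entries. -/
def MatTuple (d n : ℕ) : Type := Fin d → Matrix (Fin n) (Fin n) ℂ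

namespace MatTuple

noncomputable instance (d n : ℕ) : AddCommGroup (MatTuple d n) :=
  inferInstanceAs (AddCommGroup (Fin d → Matrix (Fin n) (Fin n) ℂ))

/-- The row norm `‖X‖ = ‖∑ X_i X_i*‖^{1/2}`, with the operator norm of matrices on the right. -/
noncomputable def rowNorm {d n : ℕ} (X : MatTuple d n) : ℝ :=
  Real.sqrt ‖∑ i, X i * (X i).conjTranspose‖

/-- The block row `[X_1 … X_d]`. -/
def blockRow {d n : ℕ} (X : MatTuple d n) : Matrix (Fin n) (Fin d × Fin n) ℂ :=
  Matrix.of fun a b => X b.1 a b.2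

theorem rowNorm_eq {d n : ℕ} (X : MatTuple d n) : rowNorm X = ‖blockRow X‖ := by
  have h : ∑ i, X i * (X i).conjTranspose = blockRow X * (blockRow X).conjTranspose := by
    ext a b
    simp [Matrix.sum_apply, Matrix.mul_apply, blockRow, Fintype.sum_prod_type]
  have h2 := Matrix.l2_opNorm_conjTranspose_mul_self (blockRow X).conjTranspose
  rw [Matrix.conjTranspose_conjTranspose, Matrix.l2_opNorm_conjTranspose] at h2
  rw [rowNorm, h, h2, Real.sqrt_mul_self (norm_nonneg _)]

/-- `M_n^d` as a normed group, hence a metric space, with the row norm. -/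
noncomputable instance (d n : ℕ) : NormedAddCommGroup (MatTuple d n) :=
  AddGroupNorm.toNormedAddCommGroup
    { toFun := rowNorm
      map_zero' := by
        rw [rowNorm_eq]
        have : blockRow (0 : MatTuple d n) = 0 := rfl
        rw [this, norm_zero]
      add_le' := fun X Y => by
        simp only [rowNorm_eq]
        exact norm_add_le (blockRow X) (blockRow Y)
      neg' := fun X => by
        simp only [rowNorm_eq]
        exact norm_neg (blockRow X)
      eq_zero_of_map_eq_zero' := fun X hX => by
        rw [rowNorm_eq, norm_eq_zero] at hX
        funext i
        ext a b
        exact congrFun (congrFun hX a) (i, b) }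

theorem norm_def {d n : ℕ} (X : MatTuple d n) :
    ‖X‖ = Real.sqrt ‖∑ i, X i * (X i).conjTranspose‖ := rfl

end MatTuple

/-- The `n`-th level `W_n(a)` of the matrix range of a tuple `a` of bounded operators on `H`: all
tuples `(φ(a_1), …, φ(a_d))` with `φ : B(H) → M_n` unital and completely positive. -/
def matrixRange {d : ℕ} {H : Type*} [NormedAddCommGroup H] [InnerProductSpace ℂ H]
    [CompleteSpace H] (n : ℕ) (a : Fin d → (H →L[ℂ] H)) : Set (MatTuple d n) :=
  {X | ∃ φ : (H →L[ℂ] H) →CP Matrix (Fin n) (Fin n) ℂ, φ 1 = 1 ∧ ∀ i, X i = φ (a i)}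

/-!
Matrix ranges are described by linear pencils, and pencils behave well under strong convergence.

*Duality.* Write `x(C, B, a) = C ⊗ 1 - ∑ k, B k ⊗ a k` in `M_n(A)`, where `C` and the `B k` are
scalar matrices, and call an element accretive if its real part is positive. A unital completely
positive map `φ` gives the positive functional `x ↦ ∑ i j, φ (x i j) i j` on `M_n(A)`, so if
`x(C, B, a)` is accretive then `Re ⟨B, Y⟩ ≤ Re tr C` on the `n`-th matrix range of `a`
(`pairing_re_le`). Conversely, if no accretive `x(C, B, a)` has `Re tr C ≤ r`, the Hahn-Banach
theorem separates the interior of the accretive cone from these pencils. The separating functional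
is a positive functional on `M_n(A)` which restricts to a multiple of the trace on scalar matrices;
normalised, it is given by a unital completely positive map, which yields a point `Y` of the matrix
range with `Re ⟨B, Y⟩ ≥ r` (`exists_le_pairing_re`). No extension theorem for completely positive
maps is needed.

*Pencils and strong convergence.* The norms of self-adjoint matrices of `*`-polynomials converge as
well, because `‖Q‖ ^ 2 ^ k = ‖Q ^ 2 ^ k‖` and the norm of an `n × n` matrix over a C⋆-algebra is
comparable to the sum of the norms of its entries, with constants that depend on `n` only
(`StronglyConverges.tendsto_norm_evalMatrix`). Accretivity of `x` means `‖m - (x + x*)‖ ≤ m` for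
large `m`, so it passes from the limit to the sequence up to a small multiple of the identity, and
from the sequence to the limit even when the coefficients vary.

*Conclusion.* Two ultrafilter arguments, one for each half of the Hausdorff distance, finish the
proof: a point at distance at least `ε` from a matrix range is separated from it by a functional,
the duality turns this functional into a pencil, and the pencil is carried to the other side, where
weak duality gives a contradiction. In the direction from `t` to the approximants the pencils depend
on the index; they have a limit because the functionals have norm one and a self-adjoint `C` in an
accretive pencil is bounded by its trace.

Almost surely, strong convergence holds simultaneously for all polynomials with coefficients in a
countable dense ring of scalars, and hence for all polynomials.
-/

/-! ### Accretive elements of a C⋆-algebra -/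

section Accretive

variable {E : Type*} [CStarAlgebra E] [PartialOrder E] [StarOrderedRing E]

/-- For an abstract C⋆-algebra, so as to apply to `CStarMatrix`, on which instance search does not
find the continuous functional calculus. -/
theorem exists_eq_star_mul_self {x : E} (hx : 0 ≤ x) : ∃ b, x = star b * b :=
  CStarAlgebra.nonneg_iff_eq_star_mul_self.mp hx

open scoped ComplexOrder in
theorem map_star_of_nonneg (s : E →ₗ[ℂ] ℂ) (hs : ∀ x, 0 ≤ x → 0 ≤ s x) (x : E) :
    s (star x) = star (s x) :=
  map_star (PositiveLinearMap.mk₀ s hs) x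

/-- An element of a C⋆-algebra is accretive if its real part is positive. -/
def IsAccretive (x : E) : Prop := 0 ≤ x + star x

namespace IsAccretive

theorem add {x y : E} (hx : IsAccretive x) (hy : IsAccretive y) : IsAccretive (x + y) := by
  have h := add_nonneg hx hy
  unfold IsAccretive
  rw [star_add]
  convert h using 1
  abel

theorem smul {x : E} (hx : IsAccretive x) {r : ℝ} (hr : 0 ≤ r) : IsAccretive (r • x) := by
  have h := smul_nonneg hr hx
  unfold IsAccretive
  rwa [star_smul, star_trivial, ← smul_add]

theorem of_nonneg {x : E} (hx : 0 ≤ x) : IsAccretive x :=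
  add_nonneg hx (star_nonneg_iff.mpr hx)

/-- The norm inequality bounds the self-adjoint element `m - (x + x*)` by `m + 2 δ`. With
`norm_sub_le` it expresses accretivity through norms, which is what strong convergence controls. -/
theorem of_norm_sub_le {x : E} {m δ : ℝ}
    (h : ‖(m : ℂ) • (1 : E) - (x + star x)‖ ≤ m + 2 * δ) :
    IsAccretive (x + (δ : ℂ) • (1 : E)) := by
  have hsa : IsSelfAdjoint ((m : ℂ) • (1 : E) - (x + star x)) := by
    simp [IsSelfAdjoint, add_comm]
  have h1 := (hsa.le_algebraMap_norm_self).trans (algebraMap_mono E h)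
  rw [Algebra.algebraMap_eq_smul_one, ← Complex.coe_smul] at h1
  have h2 := sub_nonneg.mpr h1
  unfold IsAccretive
  convert h2 using 1
  simp only [star_add, star_smul, star_one, Complex.star_def, Complex.conj_ofReal]
  push_cast
  module

theorem norm_sub_le {x : E} (hx : IsAccretive x) {m : ℝ} (hm : ‖x + star x‖ ≤ m) :
    ‖(m : ℂ) • (1 : E) - (x + star x)‖ ≤ m := by
  have hm0 : 0 ≤ m := (norm_nonneg _).trans hm
  have h1 : x + star x ≤ algebraMap ℝ E m :=
    (IsSelfAdjoint.of_nonneg hx).le_algebraMap_norm_self.trans (algebraMap_mono E hm)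
  have h2 : 0 ≤ algebraMap ℝ E m - (x + star x) := sub_nonneg.mpr h1
  have h3 : algebraMap ℝ E m = (m : ℂ) • (1 : E) := by
    rw [Algebra.algebraMap_eq_smul_one, ← Complex.coe_smul]
  rw [← h3, CStarAlgebra.norm_le_iff_le_algebraMap _ hm0 h2]
  exact sub_le_self _ hx

theorem add_smul_one_of_norm_sub_le {x y : E} (hx : IsAccretive x) {δ : ℝ}
    (h : ‖y - x‖ ≤ δ) : IsAccretive (y + (δ : ℂ) • (1 : E)) := by
  have h1 : IsAccretive ((y - x) + (δ : ℂ) • (1 : E)) := by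
    apply of_norm_sub_le (m := 0)
    simp only [Complex.ofReal_zero, zero_smul, zero_sub, norm_neg, zero_add]
    calc _ ≤ ‖y - x‖ + ‖star (y - x)‖ := norm_add_le _ _
      _ ≤ _ := by rw [norm_star]; linarith
  convert hx.add h1 using 1
  abel

theorem smul_one_add_mem_interior {x : E} (hx : IsAccretive x) {δ : ℝ} (hδ : 0 < δ) :
    (δ : ℂ) • (1 : E) + x ∈ interior {y : E | IsAccretive y} := by
  rw [mem_interior_iff_mem_nhds]
  refine Filter.mem_of_superset (Metric.closedBall_mem_nhds _ hδ) fun y hy => ?_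
  rw [mem_closedBall_iff_norm, ← sub_sub] at hy
  simpa using hx.add_smul_one_of_norm_sub_le hy

theorem convex : Convex ℝ {y : E | IsAccretive y} := fun _ hx _ hy _ _ ha hb _ =>
  (hx.smul ha).add (hy.smul hb)

theorem isClosed : IsClosed {y : E | IsAccretive y} := by
  have : {y : E | IsAccretive y} = (fun y => y + star y) ⁻¹' {x | 0 ≤ x} := rfl
  rw [this]
  exact (CStarAlgebra.isClosed_nonneg).preimage (by fun_prop)

theorem of_forall_add_smul_one {x : E}
    (h : ∀ δ : ℝ, 0 < δ → IsAccretive (x + (δ : ℂ) • (1 : E))) : IsAccretive x := by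
  have ht : Tendsto (fun δ : ℝ => x + (δ : ℂ) • (1 : E)) (𝓝[>] 0) (𝓝 x) := by
    have hc : Continuous (fun δ : ℝ => x + (δ : ℂ) • (1 : E)) := by fun_prop
    have := (hc.tendsto 0).mono_left (nhdsWithin_le_nhds (s := Set.Ioi 0))
    simpa using this
  exact isClosed.mem_of_tendsto ht (eventually_nhdsWithin_of_forall fun δ hδ => h δ hδ)

end IsAccretive

end Accretive

/-! ### Pencils, the pairing and weak duality -/

section MatrixAlgebra

open CStarMatrix

variable {A : Type*} [CStarAlgebra A] {d n : ℕ}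

/-- The matrix `C ⊗ 1` with scalar entries. -/
def scalarMatrix (A : Type*) [CStarAlgebra A] (C : Matrix (Fin n) (Fin n) ℂ) :
    CStarMatrix (Fin n) (Fin n) A :=
  ofMatrix (Matrix.of fun i j => C i j • (1 : A))

/-- The homogeneous linear pencil `∑ k, B k ⊗ a k`. -/
def pencil (B : Fin d → Matrix (Fin n) (Fin n) ℂ) (a : Fin d → A) :
    CStarMatrix (Fin n) (Fin n) A :=
  ofMatrix (Matrix.of fun i j => ∑ k, B k i j • a k)

/-- The bilinear (not sesquilinear) pairing `∑ k, tr (B kᵀ * Y k)` of `d`-tuples of matrices. -/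
def pairing (B : Fin d → Matrix (Fin n) (Fin n) ℂ) (Y : MatTuple d n) : ℂ :=
  ∑ i, ∑ j, ∑ k, B k i j * Y k i j

@[simp] theorem scalarMatrix_apply (C : Matrix (Fin n) (Fin n) ℂ) (i j : Fin n) :
    scalarMatrix A C i j = C i j • (1 : A) := rfl

@[simp] theorem pencil_apply (B : Fin d → Matrix (Fin n) (Fin n) ℂ) (a : Fin d → A)
    (i j : Fin n) : pencil B a i j = ∑ k, B k i j • a k := rfl

variable [PartialOrder A] [StarOrderedRing A]

theorem CStarMatrix.norm_le_sum (M : CStarMatrix (Fin n) (Fin n) A) :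
    ‖M‖ ≤ ∑ i, ∑ j, ‖M i j‖ := by
  rw [CStarMatrix.norm_def, Finset.sum_comm]
  refine (toCLM M).opNorm_le_bound (by positivity) fun v => ?_
  simp only [toCLM_apply_eq_sum, Finset.sum_mul]
  apply (WithCStarModule.pi_norm_le_sum_norm _).trans
  gcongr with i _
  refine (norm_sum_le Finset.univ fun j => v j * M j i).trans ?_
  gcongr with j _
  apply (norm_mul_le _ _).trans
  rw [mul_comm]
  gcongr
  exact WithCStarModule.norm_apply_le_norm v j

/-- The matrix range of a tuple in a C⋆-algebra; `matrixRange` is the case of `B(H)`. -/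
def cstarMatrixRange (n : ℕ) (a : Fin d → A) : Set (MatTuple d n) :=
  {X | ∃ φ : A →CP Matrix (Fin n) (Fin n) ℂ, φ 1 = 1 ∧ ∀ i, X i = φ (a i)}

theorem matrixRange_eq {H : Type*} [NormedAddCommGroup H] [InnerProductSpace ℂ H]
    [CompleteSpace H] (n : ℕ) (a : Fin d → (H →L[ℂ] H)) :
    matrixRange n a = cstarMatrixRange n a := rfl

/-- The functional `x ↦ ∑ i j, φ (x i j) i j`, which is the (unnormalised) vector functional of the
amplification of `φ` at the vector `(e₁, …, eₙ)`. -/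
noncomputable def entrySum (φ : A →CP Matrix (Fin n) (Fin n) ℂ)
    (x : CStarMatrix (Fin n) (Fin n) A) : ℂ :=
  ∑ i, ∑ j, φ (x i j) i j

open scoped ComplexOrder in
theorem entrySum_nonneg (φ : A →CP Matrix (Fin n) (Fin n) ℂ)
    {x : CStarMatrix (Fin n) (Fin n) A} (hx : 0 ≤ x) : 0 ≤ entrySum φ x := by
  obtain ⟨Y, hY⟩ := exists_eq_star_mul_self (φ.map_cstarMatrix_nonneg x hx)
  have h : ∀ i j, φ (x i j) = ∑ k, star (Y k i) * Y k j := fun i j => by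
    have := congrFun (congrFun hY i) j
    rw [CStarMatrix.mul_apply] at this
    exact this
  have h2 : entrySum φ x = ∑ k, ∑ l, star (∑ i, Y k i l i) * (∑ j, Y k j l j) := by
    simp only [entrySum, h, Matrix.sum_apply, Matrix.mul_apply, Matrix.star_apply, star_sum,
      Finset.sum_mul_sum]
    rw [Finset.sum_congr rfl fun i _ => Finset.sum_comm, Finset.sum_comm]
    refine Finset.sum_congr rfl fun k _ => ?_
    rw [Finset.sum_congr rfl fun i _ => Finset.sum_comm, Finset.sum_comm]
  rw [h2]
  exact Finset.sum_nonneg fun k _ => Finset.sum_nonneg fun l _ => star_mul_self_nonneg _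

open scoped ComplexOrder in
theorem entrySum_re_nonneg (φ : A →CP Matrix (Fin n) (Fin n) ℂ)
    {x : CStarMatrix (Fin n) (Fin n) A} (hx : IsAccretive x) : 0 ≤ (entrySum φ x).re := by
  have h1 := entrySum_nonneg φ hx
  have h2 : entrySum φ (x + star x) = entrySum φ x + star (entrySum φ x) := by
    have h3 : star (entrySum φ x) = ∑ i, ∑ j, star (φ (x j i) j i) := by
      simp only [entrySum, star_sum]
      rw [Finset.sum_comm]
    rw [h3]
    simp only [entrySum, CStarMatrix.add_apply, map_add, Matrix.add_apply, CStarMatrix.star_apply,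
      map_star, Matrix.star_apply, Finset.sum_add_distrib]
  rw [h2] at h1
  have := (Complex.nonneg_iff.mp h1).1
  simp at this
  linarith

/-- Weak duality: a positive pencil bounds the pairing on the matrix range. -/
theorem pairing_re_le {B : Fin d → Matrix (Fin n) (Fin n) ℂ} {C : Matrix (Fin n) (Fin n) ℂ}
    {a : Fin d → A} (h : IsAccretive (scalarMatrix A C - pencil B a)) {Y : MatTuple d n}
    (hY : Y ∈ cstarMatrixRange n a) : (pairing B Y).re ≤ C.trace.re := by
  obtain ⟨φ, h1, hφ⟩ := hY
  have h2 := entrySum_re_nonneg φ h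
  have h3 : entrySum φ (scalarMatrix A C - pencil B a) = C.trace - pairing B Y := by
    simp only [entrySum, pairing, CStarMatrix.sub_apply, scalarMatrix_apply, pencil_apply,
      map_sub, map_smul, map_sum, h1, Matrix.sub_apply, Matrix.sum_apply, Matrix.smul_apply,
      Finset.sum_sub_distrib, hφ, smul_eq_mul]
    congr 1
    simp [Matrix.trace, Matrix.one_apply]
  rw [h3, Complex.sub_re] at h2
  linarith

end MatrixAlgebra

/-! ### Positive functionals on matrices and strong duality -/

section Duality

open CStarMatrix

variable {A : Type*} [CStarAlgebra A] {d n : ℕ}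

/-- The matrix with a single entry `a`, at position `(i, j)`, as a linear map in `a`. -/
noncomputable def singleEntry (A : Type*) [CStarAlgebra A] (i j : Fin n) :
    A →ₗ[ℂ] CStarMatrix (Fin n) (Fin n) A :=
  ofMatrixₗ.toLinearMap ∘ₗ Matrix.singleLinearMap ℂ i j

theorem singleEntry_apply (i j k l : Fin n) (a : A) :
    singleEntry A i j a k l = if i = k ∧ j = l then a else 0 := rfl

theorem sum_singleEntry (x : CStarMatrix (Fin n) (Fin n) A) :
    ∑ i, ∑ j, singleEntry A i j (x i j) = x :=
  (Matrix.matrix_eq_sum_single (x : Matrix (Fin n) (Fin n) A)).symm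

theorem LinearMap.apply_eq_sum_singleEntry (s : CStarMatrix (Fin n) (Fin n) A →ₗ[ℂ] ℂ)
    (x : CStarMatrix (Fin n) (Fin n) A) : s x = ∑ i, ∑ j, s (singleEntry A i j (x i j)) := by
  conv_lhs => rw [← sum_singleEntry x]
  simp only [map_sum]

theorem star_singleEntry (i j : Fin n) (a : A) :
    star (singleEntry A i j a) = singleEntry A j i (star a) := by
  ext k l
  rw [CStarMatrix.star_apply, singleEntry_apply, singleEntry_apply, apply_ite star, star_zero]
  simp only [and_comm]

theorem scalarMatrix_one : scalarMatrix A (1 : Matrix (Fin n) (Fin n) ℂ) = 1 := by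
  ext i j
  rw [scalarMatrix_apply, CStarMatrix.one_apply, Matrix.one_apply]
  split_ifs <;> simp

theorem scalarMatrix_add (C D : Matrix (Fin n) (Fin n) ℂ) :
    scalarMatrix A (C + D) = scalarMatrix A C + scalarMatrix A D := by
  ext i j
  simp [add_smul]

theorem scalarMatrix_smul (c : ℂ) (C : Matrix (Fin n) (Fin n) ℂ) :
    scalarMatrix A (c • C) = c • scalarMatrix A C := by
  ext i j
  simp [SemigroupAction.mul_smul]

theorem scalarMatrix_conjTranspose (C : Matrix (Fin n) (Fin n) ℂ) :
    scalarMatrix A C.conjTranspose = star (scalarMatrix A C) := by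
  ext i j
  simp [CStarMatrix.star_apply]

variable [PartialOrder A] [StarOrderedRing A]

/-- Gram matrices are positive: they have the form `Z* Z` with `z` in one row of `Z`. -/
theorem gram_nonneg (z : Fin n → A) :
    0 ≤ (ofMatrix (Matrix.of fun i j => star (z i) * z j) : CStarMatrix (Fin n) (Fin n) A) := by
  rcases Nat.eq_zero_or_pos n with rfl | hn
  · exact le_of_eq (by ext i; exact i.elim0)
  let Z : CStarMatrix (Fin n) (Fin n) A :=
    ofMatrix (Matrix.of fun k i => if k = ⟨0, hn⟩ then z i else 0)
  convert star_mul_self_nonneg Z using 1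
  ext i j
  rw [CStarMatrix.mul_apply, Finset.sum_eq_single (⟨0, hn⟩ : Fin n)]
  · simp [Z, CStarMatrix.star_apply]
  · intro k _ hk
    simp [Z, CStarMatrix.star_apply, hk]
  · simp

open scoped ComplexOrder in
/-- A positive functional `s` on `M_n(A)` is given by a completely positive map `A → M_n(ℂ)`. For
`M ≥ 0` in `M_k(A)` the scalar matrix `G` with entries `s (E_ij ⊗ M_pq)` is positive semidefinite,
because its quadratic form at `x` is the value of `s` at a sum of Gram matrices. A factorisation
`G = L* L` then exhibits the amplification at `M` as a square. -/
theorem exists_completelyPositiveMap_of_nonneg (s : CStarMatrix (Fin n) (Fin n) A →ₗ[ℂ] ℂ)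
    (hs : ∀ x, 0 ≤ x → 0 ≤ s x) :
    ∃ φ : A →CP Matrix (Fin n) (Fin n) ℂ, ∀ a i j, φ a i j = s (singleEntry A i j a) := by
  let φ : A →ₗ[ℂ] Matrix (Fin n) (Fin n) ℂ :=
    { toFun := fun a => Matrix.of fun i j => s (singleEntry A i j a)
      map_add' := fun a b => by ext i j; simp
      map_smul' := fun c a => by ext i j; simp }
  have hφ : ∀ a i j, φ a i j = s (singleEntry A i j a) := fun _ _ _ => rfl
  have hstar : ∀ x, s (star x) = star (s x) := map_star_of_nonneg s hs
  refine ⟨⟨φ, fun k M hM => ?_⟩, hφ⟩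
  obtain ⟨R, rfl⟩ := exists_eq_star_mul_self hM
  set M := star R * R with hMdef
  let G : Matrix (Fin k × Fin n) (Fin k × Fin n) ℂ :=
    Matrix.of fun p q => s (singleEntry A p.2 q.2 (M p.1 q.1))
  have hG : G.PosSemidef := by
    refine Matrix.PosSemidef.of_dotProduct_mulVec_nonneg ?_ fun x => ?_
    · ext p q
      have hMs : star (M q.1 p.1) = M p.1 q.1 := by
        have : star M = M := by simp [hMdef]
        exact congrFun (congrFun this p.1) q.1
      simp only [G, Matrix.conjTranspose_apply, Matrix.of_apply]
      rw [← hstar, star_singleEntry, hMs]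
    · let z : Fin k → Fin n → A := fun l i => ∑ p, x (p, i) • R l p
      have key : star x ⬝ᵥ G.mulVec x =
          s (∑ l, ofMatrix (Matrix.of fun i j => star (z l i) * z l j)) := by
        have hentry : ∀ i j, (∑ l, (ofMatrix (Matrix.of fun i j => star (z l i) * z l j) :
            CStarMatrix (Fin n) (Fin n) A)) i j =
            ∑ p, ∑ q, (star (x (p, i)) * x (q, j)) • M p q := by
          intro i j
          have h1 : (∑ l, (ofMatrix (Matrix.of fun i j => star (z l i) * z l j) :
            CStarMatrix (Fin n) (Fin n) A)) i j = ∑ l, star (z l i) * z l j :=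
            Matrix.sum_apply i j Finset.univ
              (fun l => (Matrix.of fun i j => star (z l i) * z l j : Matrix (Fin n) (Fin n) A))
          rw [h1]
          simp only [z, star_sum, star_smul, Finset.sum_mul_sum, hMdef, CStarMatrix.mul_apply,
            CStarMatrix.star_apply, Finset.smul_sum, smul_mul_smul_comm]
          rw [Finset.sum_comm]
          exact Finset.sum_congr rfl fun p _ => Finset.sum_comm
        rw [LinearMap.apply_eq_sum_singleEntry]
        simp only [hentry, map_sum, map_smul, dotProduct, Matrix.mulVec, Fintype.sum_prod_type,
          Finset.mul_sum, Pi.star_apply, G, Matrix.of_apply, smul_eq_mul]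
        rw [Finset.sum_comm]
        refine Finset.sum_congr rfl fun i _ => ?_
        conv_lhs => enter [2, p]; rw [Finset.sum_comm]
        rw [Finset.sum_comm]
        refine Finset.sum_congr rfl fun j _ => Finset.sum_congr rfl fun p _ =>
          Finset.sum_congr rfl fun q _ => by ring
      rw [key]
      exact hs _ (Finset.sum_nonneg fun l _ => gram_nonneg (z l))
  obtain ⟨L, hL⟩ := exists_eq_star_mul_self hG.nonneg
  let L' : CStarMatrix (Fin k) (Fin k) (Matrix (Fin n) (Fin n) ℂ) :=
    ofMatrix (Matrix.of fun r q => Matrix.of fun l j => L (r, l) (q, j))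
  have : M.map φ = star L' * L' := by
    ext p q i j
    have h1 : G (p, i) (q, j) = _ := congrFun (congrFun hL (p, i)) (q, j)
    rw [Matrix.mul_apply, Fintype.sum_prod_type] at h1
    rw [CStarMatrix.mul_apply, Matrix.sum_apply]
    simp only [Matrix.mul_apply]
    exact h1
  rw [this]
  exact star_mul_self_nonneg L'

open scoped ComplexOrder in
/-- Strong duality: if no scalar matrix of trace at most `r` dominates the pencil of `B`, then the
pairing with `B` reaches `r` on the matrix range. -/
theorem exists_le_pairing_re [NeZero n] {B : Fin d → Matrix (Fin n) (Fin n) ℂ} {a : Fin d → A}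
    {r : ℝ} (h : ∀ C : Matrix (Fin n) (Fin n) ℂ, C.trace.re ≤ r →
      ¬ IsAccretive (scalarMatrix A C - pencil B a)) :
    ∃ Y ∈ cstarMatrixRange n a, r ≤ (pairing B Y).re := by
  have hn : (n : ℝ) ≠ 0 := Nat.cast_ne_zero.mpr (NeZero.ne n)
  have hnC : (n : ℂ) ≠ 0 := Nat.cast_ne_zero.mpr (NeZero.ne n)
  let K : Set (CStarMatrix (Fin n) (Fin n) A) := {x | IsAccretive x}
  let t : Set (CStarMatrix (Fin n) (Fin n) A) :=
    {x | ∃ C : Matrix (Fin n) (Fin n) ℂ, C.trace.re ≤ r ∧ x = scalarMatrix A C - pencil B a}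
  have ht : Convex ℝ t := by
    rintro _ ⟨C, hC, rfl⟩ _ ⟨D, hD, rfl⟩ p q hp hq hpq
    refine ⟨(p : ℂ) • C + (q : ℂ) • D, ?_, ?_⟩
    · simp only [Matrix.trace_add, Matrix.trace_smul, smul_eq_mul, Complex.add_re,
        Complex.re_ofReal_mul]
      calc p * C.trace.re + q * D.trace.re ≤ p * r + q * r := by gcongr
        _ = r := by rw [← add_mul, hpq, one_mul]
    · have hpq' : (p : ℂ) + q = 1 := by exact_mod_cast hpq
      rw [scalarMatrix_add, scalarMatrix_smul, scalarMatrix_smul]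
      simp only [smul_sub]
      have : pencil B a = ((p : ℂ) + q) • pencil B a := by rw [hpq', one_smul]
      conv_rhs => rw [this]
      module
  have hdisj : Disjoint (interior K) t := by
    rw [Set.disjoint_left]
    rintro _ hx ⟨C, hC, rfl⟩
    have hx' : scalarMatrix A C - pencil B a ∈ K := interior_subset hx
    exact h C hC hx'
  obtain ⟨f, u, hfK, hft⟩ := RCLike.geometric_hahn_banach_open (𝕜 := ℂ)
    (IsAccretive.convex.interior) isOpen_interior ht hdisj
  simp only [RCLike.re_to_complex] at hfK hft
  -- `f` is bounded above on the interior of the cone, hence nonpositive on the cone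
  have hK : ∀ x : CStarMatrix (Fin n) (Fin n) A, IsAccretive x → ∀ δ : ℝ, 0 < δ →
      δ * (f 1).re + (f x).re < u := fun x hx δ hδ => by
    have := hfK _ (hx.smul_one_add_mem_interior hδ)
    simpa using this
  have hle : ∀ x : CStarMatrix (Fin n) (Fin n) A, IsAccretive x → (f x).re ≤ 0 := by
    intro x hx
    by_contra! hpos
    obtain ⟨m, hm⟩ := exists_nat_gt ((u - (f 1).re) / (f x).re)
    rw [div_lt_iff₀ hpos] at hm
    have := hK _ (hx.smul (Nat.cast_nonneg m)) 1 one_pos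
    rw [← Complex.coe_smul, map_smul] at this
    simp at this
    linarith
  -- for `x ≥ 0` both `i x` and `-i x` are accretive, so `f x` is real
  have hnonpos : ∀ x : CStarMatrix (Fin n) (Fin n) A, 0 ≤ x → f x ≤ 0 := by
    intro x hx
    have hI : ∀ c : ℂ, c.re = 0 → (f (c • x)).re ≤ 0 := fun c hc => hle _ (by
      have hc' : star c = -c := by
        apply Complex.ext <;> simp [hc]
      unfold IsAccretive
      rw [star_smul, (IsSelfAdjoint.of_nonneg hx).star_eq, hc']
      simp)
    have h1 := hI Complex.I (by simp)
    have h2 := hI (-Complex.I) (by simp)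
    simp at h1 h2
    rw [Complex.le_def]
    exact ⟨hle x (.of_nonneg hx), by simp; linarith⟩
  have hu : 0 ≤ u := by
    by_contra! hu
    have h0 := hK 0 (by simp [IsAccretive])
    simp only [map_zero, Complex.zero_re, add_zero] at h0
    have h1 := h0 1 one_pos
    have h2 : (f 1).re < 0 := by linarith
    have h3 := h0 (u / (2 * (f 1).re)) (by apply div_pos_of_neg_of_neg <;> linarith)
    rw [show u / (2 * (f 1).re) * (f 1).re = u / 2 by field_simp [h2.ne]] at h3
    linarith
  -- `Re f` is bounded below on the scalar matrices with `Re tr C ≤ r`, which contain the affine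
  -- space `tr C = r`; so `f` vanishes on trace-free scalar matrices and is a multiple of the trace
  have htr0 : ∀ C : Matrix (Fin n) (Fin n) ℂ, C.trace = 0 → f (scalarMatrix A C) = 0 := by
    have hre : ∀ C : Matrix (Fin n) (Fin n) ℂ, C.trace = 0 → 0 ≤ (f (scalarMatrix A C)).re := by
      intro C hC
      by_contra! hneg
      obtain ⟨m, hm⟩ := exists_nat_gt ((u + (f (pencil B a)).re -
        (f (scalarMatrix A ((r / n : ℂ) • 1))).re) / (f (scalarMatrix A C)).re)
      rw [div_lt_iff_of_neg hneg] at hm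
      have := hft _ ⟨((r / n : ℂ) • 1) + (m : ℂ) • C, by
        simp [hC, hnC], rfl⟩
      rw [scalarMatrix_add, scalarMatrix_smul (m : ℂ)] at this
      simp at this
      linarith
    have hall : ∀ (C : Matrix (Fin n) (Fin n) ℂ), C.trace = 0 → ∀ c : ℂ,
        0 ≤ (c * f (scalarMatrix A C)).re := fun C hC c => by
      have := hre (c • C) (by simp [hC])
      rwa [scalarMatrix_smul, map_smul, smul_eq_mul] at this
    intro C hC
    have h1 := hall C hC 1
    have h2 := hall C hC (-1)
    have h3 := hall C hC Complex.I
    have h4 := hall C hC (-Complex.I)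
    simp at h1 h2 h3 h4
    apply Complex.ext <;> simp <;> linarith
  have htr : ∀ C : Matrix (Fin n) (Fin n) ℂ, f (scalarMatrix A C) = C.trace / n * f 1 := by
    intro C
    have h1 := htr0 (C - (C.trace / n) • 1) (by simp [hnC])
    have h2 : scalarMatrix A C =
        scalarMatrix A (C - (C.trace / n) • 1) + (C.trace / n) • 1 := by
      rw [← scalarMatrix_one, ← scalarMatrix_smul, ← scalarMatrix_add, sub_add_cancel]
    rw [h2, map_add, h1, zero_add, map_smul, smul_eq_mul]
  have hf1 := hnonpos 1 zero_le_one
  have hf1im : (f 1).im = 0 := (Complex.le_def.mp hf1).2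
  have hbase := hft _ ⟨(r / n : ℂ) • 1, by simp [hnC], rfl⟩
  rw [map_sub, htr, Complex.sub_re] at hbase
  have htrr : ((r / n : ℂ) • (1 : Matrix (Fin n) (Fin n) ℂ)).trace = r := by simp [hnC]
  rw [htrr] at hbase
  -- `f 1 = 0` would force `f` to vanish on the pencil, against the strict separation
  have hf1re : (f 1).re < 0 := by
    refine lt_of_le_of_ne (Complex.le_def.mp hf1).1 fun h0 => ?_
    have h0' : f 1 = 0 := Complex.ext h0 hf1im
    have hp := hle ((‖pencil B a‖ : ℂ) • 1 + -pencil B a) (by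
      rw [add_comm]
      refine IsAccretive.add_smul_one_of_norm_sub_le (x := 0) (by simp [IsAccretive]) (by simp))
    have hu' := hK 0 (by simp [IsAccretive]) 1 one_pos
    simp [h0'] at hp hbase hu'
    linarith
  set κ : ℝ := (f 1).re / n with hκ
  have hκneg : κ < 0 := div_neg_of_neg_of_pos hf1re (by
    exact_mod_cast Nat.pos_of_ne_zero (NeZero.ne n))
  have hf1κ : f 1 = n * κ := by
    apply Complex.ext
    · simp [hκ]; field_simp
    · simp [hf1im]
  let s : CStarMatrix (Fin n) (Fin n) A →ₗ[ℂ] ℂ := ((κ⁻¹ : ℝ) : ℂ) • (f : _ →ₗ[ℂ] ℂ)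
  have hs_apply : ∀ x, s x = ((κ⁻¹ : ℝ) : ℂ) * f x := fun _ => rfl
  obtain ⟨φ, hφ⟩ := exists_completelyPositiveMap_of_nonneg s fun x hx => by
    have h1 := hnonpos x hx
    rw [hs_apply]
    have h2 : ((κ⁻¹ : ℝ) : ℂ) ≤ 0 := by exact_mod_cast (inv_lt_zero.mpr hκneg).le
    exact mul_nonneg_of_nonpos_of_nonpos h2 h1
  have hκ0 : (κ : ℂ) ≠ 0 := by exact_mod_cast hκneg.ne
  have hsC : ∀ C : Matrix (Fin n) (Fin n) ℂ, s (scalarMatrix A C) = C.trace := fun C => by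
    rw [hs_apply, htr, hf1κ]
    push_cast
    field_simp
  refine ⟨fun k => φ (a k), ⟨φ, ?_, fun _ => rfl⟩, ?_⟩
  · ext i j
    have : singleEntry A i j 1 = scalarMatrix A (Matrix.single i j 1) := by
      ext k l
      rw [singleEntry_apply, scalarMatrix_apply, Matrix.single_apply]
      split_ifs <;> simp
    rw [hφ, this, hsC, Matrix.trace]
    simp only [Matrix.diag_apply, Matrix.single_apply, Matrix.one_apply]
    by_cases hij : i = j
    · subst hij; simp
    · simp only [hij, if_false]
      refine Finset.sum_eq_zero fun k _ => if_neg fun hk => hij (hk.1.trans hk.2.symm)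
  · have hpair : pairing B (fun k => φ (a k)) = s (pencil B a) := by
      rw [LinearMap.apply_eq_sum_singleEntry]
      simp only [pairing, hφ, pencil_apply, map_sum, map_smul, smul_eq_mul]
    rw [hpair, hs_apply, Complex.re_ofReal_mul]
    rw [hf1κ] at hbase
    have h5 : ((r : ℂ) / n * (n * κ)).re = r * κ := by
      rw [show (r : ℂ) / n * (n * κ) = ((r * κ : ℝ) : ℂ) by push_cast; field_simp]
      exact Complex.ofReal_re _
    rw [h5] at hbase
    rw [inv_mul_eq_div, le_div_iff_of_neg hκneg]
    linarith

end Duality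

/-! ### Strong convergence of tuples of operators -/

section StrongConvergence

open CStarMatrix

theorem exists_mul_pow_two_pow_lt {x y : ℝ} (hx : 0 ≤ x) (hxy : x < y) (c : ℝ) :
    ∃ k : ℕ, c * x ^ 2 ^ k < y ^ 2 ^ k := by
  have hy : 0 < y := hx.trans_lt hxy
  have hq0 : 0 ≤ x / y := by positivity
  have hq1 : x / y < 1 := (div_lt_one hy).mpr hxy
  obtain ⟨m, hm⟩ := exists_pow_lt_of_lt_one (show (0 : ℝ) < (|c| + 1)⁻¹ by positivity) hq1
  refine ⟨m, ?_⟩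
  have h1 : (x / y) ^ 2 ^ m < (|c| + 1)⁻¹ :=
    (pow_le_pow_of_le_one hq0 hq1.le Nat.lt_two_pow_self.le).trans_lt hm
  rw [div_pow, div_lt_iff₀ (by positivity), inv_mul_eq_div, lt_div_iff₀ (by positivity)] at h1
  have h2 : 0 ≤ x ^ 2 ^ m := by positivity
  nlinarith [le_abs_self c]

section Eval

variable {d n : ℕ} {H : Type*} [NormedAddCommGroup H] [InnerProductSpace ℂ H] [CompleteSpace H]

/-- The value of a matrix of `*`-polynomials at a tuple of operators. -/
noncomputable def evalMatrix (a : Fin d → (H →L[ℂ] H)) (Q : Matrix (Fin n) (Fin n) (StarPoly d)) :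
    CStarMatrix (Fin n) (Fin n) (H →L[ℂ] H) :=
  ofMatrix (Q.map (StarPoly.eval a))

theorem evalMatrix_apply (a : Fin d → (H →L[ℂ] H)) (Q : Matrix (Fin n) (Fin n) (StarPoly d))
    (i j : Fin n) : evalMatrix a Q i j = StarPoly.eval a (Q i j) := rfl

theorem evalMatrix_pow (a : Fin d → (H →L[ℂ] H)) (Q : Matrix (Fin n) (Fin n) (StarPoly d))
    (k : ℕ) : evalMatrix a (Q ^ k) = evalMatrix a Q ^ k := by
  induction k with
  | zero =>
    ext1 i j
    rw [evalMatrix_apply, pow_zero, pow_zero, CStarMatrix.one_apply, Matrix.one_apply]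
    split_ifs <;> simp [StarPoly.eval]
  | succ k ih =>
    rw [pow_succ, pow_succ, ← ih]
    ext1 i j
    simp only [evalMatrix_apply, CStarMatrix.mul_apply, Matrix.mul_apply]
    simp [StarPoly.eval]

/-- The sum of the norms of the entries of `Q(a)`. -/
noncomputable def entryNormSum (a : Fin d → (H →L[ℂ] H))
    (Q : Matrix (Fin n) (Fin n) (StarPoly d)) : ℝ :=
  ∑ i, ∑ j, ‖StarPoly.eval a (Q i j)‖

theorem norm_pow_le_entryNormSum (a : Fin d → (H →L[ℂ] H))
    {Q : Matrix (Fin n) (Fin n) (StarPoly d)} (hQ : IsSelfAdjoint (evalMatrix a Q)) (k : ℕ) :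
    ‖evalMatrix a Q‖ ^ 2 ^ k ≤ entryNormSum a (Q ^ 2 ^ k) := by
  rw [← hQ.norm_pow_two_pow, ← evalMatrix_pow]
  exact CStarMatrix.norm_le_sum _

theorem entryNormSum_le (a : Fin d → (H →L[ℂ] H))
    {Q : Matrix (Fin n) (Fin n) (StarPoly d)} (hQ : IsSelfAdjoint (evalMatrix a Q)) (k : ℕ) :
    entryNormSum a (Q ^ 2 ^ k) ≤ (n * n : ℝ) * ‖evalMatrix a Q‖ ^ 2 ^ k := by
  rw [← hQ.norm_pow_two_pow, ← evalMatrix_pow]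
  calc entryNormSum a (Q ^ 2 ^ k)
      ≤ ∑ _i : Fin n, ∑ _j : Fin n, ‖evalMatrix a (Q ^ 2 ^ k)‖ := by
        unfold entryNormSum
        gcongr with i _ j _
        exact CStarMatrix.norm_entry_le_norm (M := evalMatrix a (Q ^ 2 ^ k))
    _ = _ := by simp [mul_assoc]

/-- The matrix of `*`-polynomials whose value at `a` is `m - (x + x*)` for
`x = C ⊗ 1 - ∑ k, B k ⊗ a k`. -/
noncomputable def realPartPoly (m : ℂ) (C : Matrix (Fin n) (Fin n) ℂ)
    (B : Fin d → Matrix (Fin n) (Fin n) ℂ) : Matrix (Fin n) (Fin n) (StarPoly d) :=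
  Matrix.of fun i j => (if i = j then m • 1 else 0) -
    ((C i j • 1 - ∑ k, B k i j • FreeAlgebra.ι ℂ (Sum.inl k)) +
      (star (C j i) • 1 - ∑ k, star (B k j i) • FreeAlgebra.ι ℂ (Sum.inr k)))

theorem evalMatrix_realPartPoly (a : Fin d → (H →L[ℂ] H)) (m : ℂ) (C : Matrix (Fin n) (Fin n) ℂ)
    (B : Fin d → Matrix (Fin n) (Fin n) ℂ) :
    evalMatrix a (realPartPoly m C B) = m • 1 -
      ((scalarMatrix _ C - pencil B a) + star (scalarMatrix _ C - pencil B a)) := by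
  ext1 i j
  rw [evalMatrix_apply, CStarMatrix.sub_apply, CStarMatrix.add_apply, CStarMatrix.star_apply,
    CStarMatrix.smul_apply, CStarMatrix.one_apply]
  simp only [realPartPoly, Matrix.of_apply, StarPoly.eval, map_sub, map_add, map_smul, map_one,
    map_sum, FreeAlgebra.lift_ι_apply, Sum.elim_inl, Sum.elim_inr, CStarMatrix.sub_apply,
    scalarMatrix_apply, pencil_apply, star_sub, star_smul, star_sum, star_one,
    ContinuousLinearMap.star_eq_adjoint, apply_ite (FreeAlgebra.lift ℂ _), map_zero, smul_ite,
    smul_zero]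

end Eval

variable {d n : ℕ} {ι : Type*} {l : Filter ι} {G : ι → Type*} [∀ i, NormedAddCommGroup (G i)]
  [∀ i, InnerProductSpace ℂ (G i)] [∀ i, CompleteSpace (G i)]
  {H : Type*} [NormedAddCommGroup H] [InnerProductSpace ℂ H] [CompleteSpace H]

/-- Strong convergence of tuples of operators along a filter: convergence of the norm of every
`*`-polynomial. -/
def StronglyConverges (l : Filter ι) (a : (i : ι) → Fin d → (G i →L[ℂ] G i))
    (t : Fin d → (H →L[ℂ] H)) : Prop :=
  ∀ p : StarPoly d, Tendsto (fun i => ‖StarPoly.eval (a i) p‖) l (𝓝 ‖StarPoly.eval t p‖)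

namespace StronglyConverges

variable {a : (i : ι) → Fin d → (G i →L[ℂ] G i)} {t : Fin d → (H →L[ℂ] H)}

/-- Strong convergence passes to self-adjoint matrices of `*`-polynomials: by the C⋆-identity
`‖Q‖ ^ 2 ^ k = ‖Q ^ 2 ^ k‖`, and up to the factor `n ^ 2`, which is lost when the `2 ^ k`-th
root is taken, the norm of a matrix is the sum of the norms of its entries. -/
theorem tendsto_norm_evalMatrix (h : StronglyConverges l a t)
    {Q : Matrix (Fin n) (Fin n) (StarPoly d)} (hQa : ∀ i, IsSelfAdjoint (evalMatrix (a i) Q))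
    (hQt : IsSelfAdjoint (evalMatrix t Q)) :
    Tendsto (fun i => ‖evalMatrix (a i) Q‖) l (𝓝 ‖evalMatrix t Q‖) := by
  have hS : ∀ R : Matrix (Fin n) (Fin n) (StarPoly d),
      Tendsto (fun i => entryNormSum (a i) R) l (𝓝 (entryNormSum t R)) := fun R =>
    tendsto_finsetSum _ fun i _ => tendsto_finsetSum _ fun j _ => h (R i j)
  rw [tendsto_order]
  refine ⟨fun y hy => ?_, fun y hy => ?_⟩
  · rcases lt_or_ge y 0 with hy0 | hy0
    · exact Eventually.of_forall fun i => hy0.trans_le (norm_nonneg _)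
    obtain ⟨k, hk⟩ := exists_mul_pow_two_pow_lt hy0 hy (n * n)
    filter_upwards [(hS (Q ^ 2 ^ k)).eventually_const_lt
      (hk.trans_le (norm_pow_le_entryNormSum t hQt k))] with i hi
    have h1 := hi.trans_le (entryNormSum_le (a i) (hQa i) k)
    exact lt_of_pow_lt_pow_left₀ _ (norm_nonneg _) (lt_of_mul_lt_mul_left h1 (by positivity))
  · obtain ⟨k, hk⟩ := exists_mul_pow_two_pow_lt (norm_nonneg _) hy (n * n)
    filter_upwards [(hS (Q ^ 2 ^ k)).eventually_lt_const
      ((entryNormSum_le t hQt k).trans_lt hk)] with i hi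
    exact lt_of_pow_lt_pow_left₀ _ ((norm_nonneg _).trans hy.le)
      ((norm_pow_le_entryNormSum (a i) (hQa i) k).trans_lt hi)

theorem tendsto_norm_sub_realPart (h : StronglyConverges l a t) (m : ℝ)
    (C : Matrix (Fin n) (Fin n) ℂ) (B : Fin d → Matrix (Fin n) (Fin n) ℂ) :
    Tendsto (fun i => ‖(m : ℂ) • 1 -
      ((scalarMatrix _ C - pencil B (a i)) + star (scalarMatrix _ C - pencil B (a i)))‖) l
      (𝓝 ‖(m : ℂ) • 1 - ((scalarMatrix _ C - pencil B t) + star (scalarMatrix _ C - pencil B t))‖)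
      := by
  simp only [← evalMatrix_realPartPoly]
  apply h.tendsto_norm_evalMatrix <;> intros <;> rw [evalMatrix_realPartPoly] <;>
    simp [IsSelfAdjoint, add_comm]

theorem tendsto_norm (h : StronglyConverges l a t) (k : Fin d) :
    Tendsto (fun i => ‖a i k‖) l (𝓝 ‖t k‖) := by
  simpa [StarPoly.eval] using h (FreeAlgebra.ι ℂ (Sum.inl k))

theorem tendsto_norm_one (h : StronglyConverges l a t) :
    Tendsto (fun i => ‖(1 : G i →L[ℂ] G i)‖) l (𝓝 ‖(1 : H →L[ℂ] H)‖) := by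
  simpa [StarPoly.eval] using h 1

/-- Accretivity of a pencil passes from the limit to the approximants, up to a small multiple of the
identity. -/
theorem eventually_isAccretive (h : StronglyConverges l a t) {C : Matrix (Fin n) (Fin n) ℂ}
    {B : Fin d → Matrix (Fin n) (Fin n) ℂ} (hx : IsAccretive (scalarMatrix _ C - pencil B t))
    {δ : ℝ} (hδ : 0 < δ) :
    ∀ᶠ i in l, IsAccretive (scalarMatrix _ (C + (δ : ℂ) • 1) - pencil B (a i)) := by
  have h1 := hx.norm_sub_le le_rfl
  filter_upwards [(h.tendsto_norm_sub_realPart _ C B).eventually_lt_const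
    (h1.trans_lt (lt_add_of_pos_right _ (mul_pos two_pos hδ)))] with i hi
  have h2 := IsAccretive.of_norm_sub_le hi.le
  rw [scalarMatrix_add, scalarMatrix_smul, scalarMatrix_one]
  convert h2 using 1
  abel

/-- Accretivity of pencils with convergent coefficients passes from the approximants to the
limit. -/
theorem isAccretive_of_tendsto [l.NeBot] (h : StronglyConverges l a t)
    {C' : ι → Matrix (Fin n) (Fin n) ℂ} {B' : ι → Fin d → Matrix (Fin n) (Fin n) ℂ}
    {C : Matrix (Fin n) (Fin n) ℂ} {B : Fin d → Matrix (Fin n) (Fin n) ℂ}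
    (hC : ∀ p q, Tendsto (fun i => C' i p q) l (𝓝 (C p q)))
    (hB : ∀ k p q, Tendsto (fun i => B' i k p q) l (𝓝 (B k p q)))
    (hx : ∀ᶠ i in l, IsAccretive (scalarMatrix _ (C' i) - pencil (B' i) (a i))) :
    IsAccretive (scalarMatrix _ C - pencil B t) := by
  -- the norm of the change that replacing the coefficients by their limits causes is at most `g i`
  let g : ι → ℝ := fun i => ∑ p, ∑ q, (‖C p q - C' i p q‖ * ‖(1 : G i →L[ℂ] G i)‖ +
    ∑ k, ‖B k p q - B' i k p q‖ * ‖a i k‖)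
  have hg : Tendsto g l (𝓝 0) := by
    have : Tendsto g l (𝓝 (∑ p, ∑ q, (‖C p q - C p q‖ * ‖(1 : H →L[ℂ] H)‖ +
        ∑ k, ‖B k p q - B k p q‖ * ‖t k‖))) :=
      tendsto_finsetSum _ fun p _ => tendsto_finsetSum _ fun q _ =>
        (((tendsto_const_nhds.sub (hC p q)).norm).mul h.tendsto_norm_one).add
        (tendsto_finsetSum _ fun k _ =>
          ((tendsto_const_nhds.sub (hB k p q)).norm).mul (h.tendsto_norm k))
    simpa using this
  have hle : ∀ i, ‖(scalarMatrix _ C - pencil B (a i)) -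
      (scalarMatrix _ (C' i) - pencil (B' i) (a i))‖ ≤ g i := fun i => by
    refine (CStarMatrix.norm_le_sum _).trans ?_
    refine Finset.sum_le_sum fun p _ => Finset.sum_le_sum fun q _ => ?_
    have : ((scalarMatrix (G i →L[ℂ] G i) C - pencil B (a i)) -
        (scalarMatrix (G i →L[ℂ] G i) (C' i) - pencil (B' i) (a i))) p q =
        (C p q - C' i p q) • (1 : G i →L[ℂ] G i) - ∑ k, (B k p q - B' i k p q) • a i k := by
      simp only [CStarMatrix.sub_apply, scalarMatrix_apply, pencil_apply, sub_smul,
        Finset.sum_sub_distrib]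
      abel
    rw [this]
    refine (_root_.norm_sub_le _ _).trans (add_le_add (_root_.norm_smul_le _ _) ?_)
    exact (norm_sum_le _ _).trans (Finset.sum_le_sum fun k _ => _root_.norm_smul_le _ _)
  refine IsAccretive.of_forall_add_smul_one fun δ hδ => ?_
  have hadd : scalarMatrix _ C - pencil B t + (δ : ℂ) • 1 =
      scalarMatrix _ (C + (δ : ℂ) • 1) - pencil B t := by
    rw [scalarMatrix_add, scalarMatrix_smul, scalarMatrix_one]
    abel
  rw [hadd]
  set D := C + (δ : ℂ) • (1 : Matrix (Fin n) (Fin n) ℂ) with hD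
  have hacc : ∀ᶠ i in l, IsAccretive (scalarMatrix _ D - pencil B (a i)) := by
    filter_upwards [hx, hg.eventually_le_const hδ] with i hi hgi
    have := hi.add_smul_one_of_norm_sub_le ((hle i).trans hgi)
    rw [hD, scalarMatrix_add, scalarMatrix_smul, scalarMatrix_one]
    convert this using 1
    abel
  set m := ‖(scalarMatrix _ D - pencil B t) + star (scalarMatrix _ D - pencil B t)‖ + 1 with hm
  -- the case `m = 0` of `tendsto_norm_sub_realPart` bounds the real parts themselves
  have hbd : ∀ᶠ i in l, ‖(scalarMatrix _ D - pencil B (a i)) +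
      star (scalarMatrix _ D - pencil B (a i))‖ ≤ m := by
    have h0 := h.tendsto_norm_sub_realPart 0 D B
    simp only [Complex.ofReal_zero, zero_smul, zero_sub, norm_neg] at h0
    exact h0.eventually_le_const (lt_add_one _)
  have hlim : ‖(m : ℂ) • 1 - ((scalarMatrix _ D - pencil B t) +
      star (scalarMatrix _ D - pencil B t))‖ ≤ m := by
    refine le_of_tendsto (h.tendsto_norm_sub_realPart m D B) ?_
    filter_upwards [hacc, hbd] with i h1 h2 using h1.norm_sub_le h2
  have := IsAccretive.of_norm_sub_le (δ := 0) (hlim.trans (by simp))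
  simpa using this

end StronglyConverges

end StrongConvergence

/-! ### The normed space of tuples and separation with a margin -/

section TupleSpace

namespace MatTuple

variable {d n : ℕ}

noncomputable instance : Module ℂ (MatTuple d n) :=
  inferInstanceAs (Module ℂ (Fin d → Matrix (Fin n) (Fin n) ℂ))

noncomputable instance : NormedSpace ℂ (MatTuple d n) where
  norm_smul_le c X := by
    change rowNorm (c • X) ≤ ‖c‖ * rowNorm X
    rw [rowNorm_eq, rowNorm_eq]
    exact norm_smul_le c (blockRow X)

instance : FiniteDimensional ℂ (MatTuple d n) :=
  inferInstanceAs (Module.Finite ℂ (Fin d → Matrix (Fin n) (Fin n) ℂ))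

instance : ProperSpace (MatTuple d n) := FiniteDimensional.proper ℂ _

/-- The tuple whose only non-zero entry is a `1`, in the matrix `k` at position `(i, j)`. -/
def unitTuple (i j : Fin n) (k : Fin d) : MatTuple d n :=
  fun m => if m = k then Matrix.single i j 1 else 0

theorem sum_smul_unitTuple (Y : MatTuple d n) :
    ∑ i, ∑ j, ∑ k, Y k i j • unitTuple i j k = Y := by
  have h : ∀ m, (∑ i, ∑ j, ∑ k, Y k i j • unitTuple i j k) m =
      ∑ i, ∑ j, ∑ k, Y k i j • unitTuple i j k m := by
    intro m
    refine (Finset.sum_apply m Finset.univ _).trans (Finset.sum_congr rfl fun i _ => ?_)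
    refine (Finset.sum_apply m Finset.univ _).trans (Finset.sum_congr rfl fun j _ => ?_)
    exact Finset.sum_apply m Finset.univ _
  funext m
  rw [h]
  simp only [unitTuple, smul_ite, smul_zero, Finset.sum_ite_eq, Finset.mem_univ, if_true,
    Matrix.smul_single, smul_eq_mul, mul_one]
  exact (Matrix.matrix_eq_sum_single (Y m)).symm

/-- The tuple of matrices that represents a functional through `pairing`. -/
noncomputable def coeff (f : StrongDual ℂ (MatTuple d n)) : Fin d → Matrix (Fin n) (Fin n) ℂ :=
  fun k => Matrix.of fun i j => f (unitTuple i j k)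

theorem pairing_coeff (f : StrongDual ℂ (MatTuple d n)) (Y : MatTuple d n) :
    pairing (coeff f) Y = f Y := by
  conv_rhs => rw [← sum_smul_unitTuple Y]
  simp only [map_sum, map_smul, pairing, coeff, Matrix.of_apply, smul_eq_mul, mul_comm]

end MatTuple

/-- Separation with a margin: a convex set that misses the ball of radius `ε` around `X` is
separated from `X` by a functional of norm one with margin `ε / 2`. -/
theorem exists_norm_eq_one_re_le_sub {E : Type*} [NormedAddCommGroup E] [NormedSpace ℂ E]
    {W : Set E} (hW : Convex ℝ W) (hne : W.Nonempty) {X : E} {ε : ℝ} (hε : 0 < ε)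
    (h : ∀ Y ∈ W, ε ≤ dist X Y) :
    ∃ f : StrongDual ℂ E, ‖f‖ = 1 ∧ ∀ Y ∈ W, (f Y).re ≤ (f X).re - ε / 2 := by
  have hdisj : Disjoint (Metric.ball X ε) W := by
    rw [Set.disjoint_left]
    intro Y hY hYW
    rw [Metric.mem_ball, dist_comm] at hY
    exact absurd hY (h Y hYW).not_gt
  obtain ⟨g, u, hg1, hg2⟩ := RCLike.geometric_hahn_banach_open (𝕜 := ℂ)
    (convex_ball X ε) Metric.isOpen_ball hW hdisj
  simp only [RCLike.re_to_complex] at hg1 hg2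
  obtain ⟨Y₀, hY₀⟩ := hne
  have hg0 : 0 < ‖g‖ := by
    rw [norm_pos_iff]
    rintro rfl
    have := (hg1 X (Metric.mem_ball_self hε)).trans_le (hg2 Y₀ hY₀)
    simp at this
  obtain ⟨z, hz1, hz2⟩ := g.exists_lt_apply_of_lt_opNorm (half_lt_self hg0)
  have hgz : 0 < ‖g z‖ := (half_pos hg0).trans hz2
  -- the unimodular factor `conj (g z) / ‖g z‖` makes the value of `g` real and positive
  set w : E := (starRingEnd ℂ (g z) / ‖g z‖) • z with hw
  have hgw : g w = (‖g z‖ : ℂ) := by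
    rw [hw, map_smul, smul_eq_mul, div_mul_eq_mul_div, mul_comm, Complex.mul_conj,
      Complex.normSq_eq_norm_sq]
    have : (‖g z‖ : ℂ) ≠ 0 := by exact_mod_cast hgz.ne'
    push_cast
    field_simp
  have hwn : ‖w‖ < 1 := by
    rw [hw, norm_smul, norm_div, RCLike.norm_conj, Complex.norm_real, norm_norm, div_self hgz.ne',
      one_mul]
    exact hz1
  have hball : X + (ε : ℂ) • w ∈ Metric.ball X ε := by
    rw [mem_ball_iff_norm, add_sub_cancel_left, norm_smul, Complex.norm_real,
      Real.norm_of_nonneg hε.le]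
    nlinarith
  refine ⟨-((‖g‖⁻¹ : ℝ) : ℂ) • g, ?_, fun Y hY => ?_⟩
  · rw [norm_smul, norm_neg, Complex.norm_real, norm_inv, norm_norm, inv_mul_cancel₀ hg0.ne']
  · have h1 := (hg1 _ hball).trans_le (hg2 Y hY)
    rw [map_add, map_smul, hgw, smul_eq_mul, ← Complex.ofReal_mul, Complex.add_re,
      Complex.ofReal_re] at h1
    have h2 : (g X).re + ε * (‖g‖ / 2) ≤ (g Y).re := by nlinarith
    have h3 := mul_le_mul_of_nonneg_left h2 (inv_nonneg.mpr hg0.le)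
    have h4 : ‖g‖⁻¹ * ((g X).re + ε * (‖g‖ / 2)) = ‖g‖⁻¹ * (g X).re + ε / 2 := by
      field_simp
    simp only [_root_.smul_apply, smul_eq_mul, neg_mul, Complex.neg_re, Complex.re_ofReal_mul]
    linarith

theorem Ultrafilter.exists_tendsto_of_norm_le {ι E : Type*} [NormedAddCommGroup E] [ProperSpace E]
    (l : Ultrafilter ι) {x : ι → E} {R : ℝ} (h : ∀ᶠ i in l, ‖x i‖ ≤ R) :
    ∃ y, Tendsto x l (𝓝 y) := by
  obtain ⟨y, -, hy⟩ := (isCompact_closedBall (0 : E) R).ultrafilter_le_nhds (l.map x) (by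
    rw [Ultrafilter.coe_map, Filter.le_principal_iff, Filter.mem_map]
    filter_upwards [h] with i hi
    simpa using hi)
  exact ⟨y, hy⟩

end TupleSpace

/-! ### Convexity and boundedness of matrix ranges -/

section MatrixRange

open CStarMatrix

variable {A : Type*} [CStarAlgebra A] [PartialOrder A] [StarOrderedRing A] {d n : ℕ}

theorem nonneg_smul_add_smul {E : Type*} [CStarAlgebra E] [PartialOrder E] [StarOrderedRing E]
    {x y : E} (hx : 0 ≤ x) (hy : 0 ≤ y) {p q : ℝ} (hp : 0 ≤ p) (hq : 0 ≤ q) :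
    0 ≤ (p : ℂ) • x + (q : ℂ) • y := by
  rw [Complex.coe_smul, Complex.coe_smul]
  exact add_nonneg (smul_nonneg hp hx) (smul_nonneg hq hy)

theorem convex_cstarMatrixRange (n : ℕ) (a : Fin d → A) : Convex ℝ (cstarMatrixRange n a) := by
  rintro X ⟨φ, h1, hφ⟩ Y ⟨ψ, h2, hψ⟩ p q hp hq hpq
  let χ : A →ₗ[ℂ] Matrix (Fin n) (Fin n) ℂ :=
    (p : ℂ) • (φ : A →ₗ[ℂ] Matrix (Fin n) (Fin n) ℂ) + (q : ℂ) • (ψ : A →ₗ[ℂ] _)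
  have hχ : ∀ x, χ x = (p : ℂ) • φ x + (q : ℂ) • ψ x := fun _ => rfl
  refine ⟨⟨χ, fun k M hM => ?_⟩, ?_, fun i => ?_⟩
  · have : M.map χ = (p : ℂ) • M.map φ + (q : ℂ) • M.map ψ := rfl
    rw [this]
    exact nonneg_smul_add_smul (φ.map_cstarMatrix_nonneg M hM) (ψ.map_cstarMatrix_nonneg M hM)
      hp hq
  · change χ 1 = 1
    rw [hχ, h1, h2, ← add_smul]
    have : (p : ℂ) + q = 1 := by exact_mod_cast hpq
    rw [this, one_smul]
  · change _ = χ (a i)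
    rw [hχ, ← hφ, ← hψ, ← Complex.coe_smul, ← Complex.coe_smul]
    rfl

/-- At level zero the zero map is unital, and the matrix range is the whole one-point space. -/
theorem cstarMatrixRange_zero {A : Type*} [CStarAlgebra A] [PartialOrder A] [StarOrderedRing A]
    (b : Fin d → A) : cstarMatrixRange 0 b = Set.univ := by
  refine Set.eq_univ_of_forall fun X => ⟨⟨0, fun k M _ => le_of_eq ?_⟩, ?_, fun i => ?_⟩
  · ext p q i
    exact i.elim0
  · ext i
    exact i.elim0
  · ext p
    exact p.elim0

/-- The entries of the matrix range are bounded by weak duality, applied to the functionals that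
read off one entry up to a phase. -/
theorem norm_entry_le_of_mem {a : Fin d → A} {Y : MatTuple d n} (hY : Y ∈ cstarMatrixRange n a)
    (k : Fin d) (i j : Fin n) : ‖Y k i j‖ ≤ n * ‖a k‖ := by
  obtain ⟨c, hc1, hc2⟩ : ∃ c : ℂ, ‖c‖ = 1 ∧ c * Y k i j = ‖Y k i j‖ := by
    rcases eq_or_ne (Y k i j) 0 with h0 | h0
    · exact ⟨1, by simp, by simp [h0]⟩
    · have h1 : ‖Y k i j‖ ≠ 0 := norm_ne_zero_iff.mpr h0
      refine ⟨starRingEnd ℂ (Y k i j) / ‖Y k i j‖, ?_, ?_⟩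
      · rw [norm_div, RCLike.norm_conj, Complex.norm_real, norm_norm, div_self h1]
      · rw [div_mul_eq_mul_div, mul_comm, Complex.mul_conj, Complex.normSq_eq_norm_sq]
        have : (‖Y k i j‖ : ℂ) ≠ 0 := by exact_mod_cast h1
        push_cast
        field_simp
  let B : Fin d → Matrix (Fin n) (Fin n) ℂ := fun m => if m = k then Matrix.single i j c else 0
  have hBe : ∀ p q m, B m p q = if p = i ∧ q = j ∧ m = k then c else 0 := by
    intro p q m
    by_cases hm : m = k
    · subst hm; simp [B, Matrix.single_apply, eq_comm]
    · simp [B, hm]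
  have hpair : pairing B Y = ‖Y k i j‖ := by
    rw [← hc2, pairing, Finset.sum_eq_single i, Finset.sum_eq_single j, Finset.sum_eq_single k]
    all_goals simp +contextual [hBe]
  have hnorm : ‖pencil B a‖ ≤ ‖a k‖ := by
    refine (CStarMatrix.norm_le_sum _).trans ?_
    rw [Finset.sum_eq_single i, Finset.sum_eq_single j, pencil_apply, Finset.sum_eq_single k]
    · simp [hBe, norm_smul, hc1]
    all_goals simp +contextual [hBe]
  have hacc : IsAccretive (scalarMatrix A ((‖a k‖ : ℂ) • 1) - pencil B a) := by
    rw [scalarMatrix_smul, scalarMatrix_one, sub_eq_add_neg, add_comm]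
    exact IsAccretive.add_smul_one_of_norm_sub_le (x := 0) (by simp [IsAccretive]) (by simpa)
  have := pairing_re_le hacc hY
  rw [hpair] at this
  simpa [mul_comm] using this

theorem norm_le_of_mem {a : Fin d → A} {Y : MatTuple d n} (hY : Y ∈ cstarMatrixRange n a) :
    ‖Y‖ ≤ ∑ i, ∑ j, ∑ k, n * ‖a k‖ * ‖(MatTuple.unitTuple i j k : MatTuple d n)‖ := by
  conv_lhs => rw [← MatTuple.sum_smul_unitTuple Y]
  refine (norm_sum_le _ _).trans (Finset.sum_le_sum fun i _ => ?_)
  refine (norm_sum_le _ _).trans (Finset.sum_le_sum fun j _ => ?_)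
  refine (norm_sum_le _ _).trans (Finset.sum_le_sum fun k _ => ?_)
  rw [norm_smul]
  gcongr
  exact norm_entry_le_of_mem hY k i j

open scoped ComplexOrder in
theorem nonneg_of_smul_one_nonneg [Nontrivial A] {c : ℂ} (h : 0 ≤ c • (1 : A)) : 0 ≤ c := by
  refine spectrum_nonneg_of_nonneg h ?_
  rw [← Algebra.algebraMap_eq_smul_one, spectrum.scalar_eq]
  rfl

open scoped ComplexOrder in
theorem diag_nonneg_of_scalarMatrix_nonneg [Nontrivial A] {D : Matrix (Fin n) (Fin n) ℂ}
    (h : 0 ≤ scalarMatrix A D) (p : Fin n) : 0 ≤ D p p := by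
  obtain ⟨Y, hY⟩ := exists_eq_star_mul_self h
  refine nonneg_of_smul_one_nonneg (A := A) ?_
  rw [← scalarMatrix_apply, hY, CStarMatrix.mul_apply]
  exact Finset.sum_nonneg fun l _ => star_mul_self_nonneg (Y l p)

open scoped ComplexOrder in
theorem norm_entry_le_of_scalarMatrix_nonneg [Nontrivial A] {D : Matrix (Fin n) (Fin n) ℂ}
    (h : 0 ≤ scalarMatrix A D) (p q : Fin n) : ‖D p q‖ ≤ n * D.trace.re := by
  have hdiag := diag_nonneg_of_scalarMatrix_nonneg h
  have htr : ∀ p, ‖D p p‖ ≤ D.trace.re := fun p => by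
    rw [← Complex.re_eq_norm.mpr (hdiag p), Matrix.trace, Complex.re_sum]
    exact Finset.single_le_sum (f := fun i => (D i i).re)
      (fun i _ => (Complex.nonneg_iff.mp (hdiag i)).1) (Finset.mem_univ p)
  have htr0 : 0 ≤ D.trace.re := (norm_nonneg _).trans (htr p)
  obtain ⟨Y, hY⟩ := exists_eq_star_mul_self h
  have hent : ∀ p q, D p q • (1 : A) = ∑ l, star (Y l p) * Y l q := fun p q => by
    rw [← scalarMatrix_apply, hY, CStarMatrix.mul_apply]
    rfl
  have hnorm : ∀ c : ℂ, ‖c • (1 : A)‖ = ‖c‖ := fun c => by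
    rw [norm_smul, CStarRing.norm_one, mul_one]
  have hYle : ∀ l p, ‖Y l p‖ ^ 2 ≤ D.trace.re := fun l p => by
    rw [sq, ← CStarRing.norm_star_mul_self]
    refine le_trans ?_ (htr p)
    rw [← hnorm, hent]
    exact CStarAlgebra.norm_le_norm_of_nonneg_of_le (star_mul_self_nonneg _)
      (Finset.single_le_sum (f := fun l => star (Y l p) * Y l p)
        (fun l _ => star_mul_self_nonneg _) (Finset.mem_univ l))
  rw [← hnorm, hent]
  calc ‖∑ l, star (Y l p) * Y l q‖ ≤ ∑ l, ‖star (Y l p) * Y l q‖ := norm_sum_le _ _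
    _ ≤ ∑ _l : Fin n, D.trace.re := by
      refine Finset.sum_le_sum fun l _ => (norm_mul_le _ _).trans ?_
      rw [norm_star]
      nlinarith [hYle l p, hYle l q, sq_nonneg (‖Y l p‖ - ‖Y l q‖)]
    _ = n * D.trace.re := by simp

/-- In an accretive pencil the scalar coefficient may be taken self-adjoint, and then it is bounded
by its trace and the norm of the pencil. -/
theorem exists_isAccretive_norm_entry_le [Nontrivial A] {C : Matrix (Fin n) (Fin n) ℂ}
    {B : Fin d → Matrix (Fin n) (Fin n) ℂ} {a : Fin d → A} {R : ℝ} (hR : ‖pencil B a‖ ≤ R)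
    (h : IsAccretive (scalarMatrix A C - pencil B a)) :
    ∃ D : Matrix (Fin n) (Fin n) ℂ, IsAccretive (scalarMatrix A D - pencil B a) ∧
      D.trace.re = C.trace.re ∧
      ∀ p q, ‖D p q‖ ≤ n * (C.trace.re + n * R) + R := by
  have hR0 : 0 ≤ R := (norm_nonneg _).trans hR
  set D : Matrix (Fin n) (Fin n) ℂ := (1 / 2 : ℂ) • (C + C.conjTranspose) with hD
  have hDC : scalarMatrix A D = (1 / 2 : ℂ) • (scalarMatrix A C + star (scalarMatrix A C)) := by
    rw [hD, scalarMatrix_smul, scalarMatrix_add, scalarMatrix_conjTranspose]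
  have hDs : star (scalarMatrix A D) = scalarMatrix A D := by
    rw [hDC, star_smul, star_add, star_star, add_comm]
    simp
  have hacc : IsAccretive (scalarMatrix A D - pencil B a) := by
    unfold IsAccretive at h ⊢
    convert h using 1
    rw [star_sub, star_sub, hDs, hDC]
    module
  have htr : D.trace.re = C.trace.re := by
    rw [hD, Matrix.trace_smul, Matrix.trace_add, Matrix.trace_conjTranspose]
    simp
    ring
  have hP : 0 ≤ scalarMatrix A (D + (R : ℂ) • 1) := by
    have h1 : IsAccretive (pencil B a + (R : ℂ) • 1) :=
      IsAccretive.add_smul_one_of_norm_sub_le (x := 0) (by simp [IsAccretive]) (by simpa)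
    have h2 := hacc.add h1
    rw [← add_assoc, sub_add_cancel, ← scalarMatrix_one, ← scalarMatrix_smul,
      ← scalarMatrix_add] at h2
    have h3 : star (scalarMatrix A (D + (R : ℂ) • 1)) = scalarMatrix A (D + (R : ℂ) • 1) := by
      rw [scalarMatrix_add, star_add, hDs, scalarMatrix_smul (R : ℂ), scalarMatrix_one, star_smul]
      simp
    have h4 := nonneg_smul_add_smul h2 h2 (p := 1 / 4) (q := 1 / 4) (by norm_num) (by norm_num)
    rw [h3] at h4
    convert h4 using 1
    push_cast
    module
  refine ⟨D, hacc, htr, fun p q => ?_⟩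
  have h1 := norm_entry_le_of_scalarMatrix_nonneg hP p q
  have h2 : (D + (R : ℂ) • (1 : Matrix (Fin n) (Fin n) ℂ)).trace.re = C.trace.re + n * R := by
    simp [htr, mul_comm]
  rw [h2] at h1
  have h3 : ‖((R : ℂ) • (1 : Matrix (Fin n) (Fin n) ℂ)) p q‖ ≤ R := by
    rw [Matrix.smul_apply, Matrix.one_apply]
    split_ifs <;> simp [abs_of_nonneg hR0, hR0]
  calc ‖D p q‖ = ‖(D + (R : ℂ) • 1) p q - ((R : ℂ) • (1 : Matrix (Fin n) (Fin n) ℂ)) p q‖ := by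
        rw [Matrix.add_apply, add_sub_cancel_right]
    _ ≤ _ := (norm_sub_le _ _).trans (add_le_add h1 h3)

theorem cstarMatrixRange_nonempty [Nontrivial A] [NeZero n] (a : Fin d → A) :
    (cstarMatrixRange n a).Nonempty := by
  obtain ⟨Y, hY, -⟩ := exists_le_pairing_re (n := n) (B := 0) (a := a) (r := -1) fun C hC h => by
    have hp0 : pencil (0 : Fin d → Matrix (Fin n) (Fin n) ℂ) a = 0 := by
      ext i j
      simp
    rw [hp0, sub_zero] at h
    unfold IsAccretive at h
    rw [← scalarMatrix_conjTranspose, ← scalarMatrix_add] at h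
    have h1 : 0 ≤ C.trace.re := by
      rw [Matrix.trace, Complex.re_sum]
      refine Finset.sum_nonneg fun i _ => ?_
      have := (Complex.nonneg_iff.mp (diag_nonneg_of_scalarMatrix_nonneg h i)).1
      simp at this
      exact this
    linarith
  exact ⟨Y, hY⟩

end MatrixRange

/-! ### Hausdorff convergence of matrix ranges -/

section Hausdorff

variable {d n : ℕ} {ι : Type*} {G : ι → Type*} [∀ i, NormedAddCommGroup (G i)]
  [∀ i, InnerProductSpace ℂ (G i)] [∀ i, CompleteSpace (G i)]
  {H : Type*} [NormedAddCommGroup H] [InnerProductSpace ℂ H] [CompleteSpace H]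
  {a : (i : ι) → Fin d → (G i →L[ℂ] G i)} {t : Fin d → (H →L[ℂ] H)}

theorem nontrivial_of_norm_one_pos {K : Type*} [NormedAddCommGroup K] [InnerProductSpace ℂ K]
    (h : 0 < ‖(1 : K →L[ℂ] K)‖) : Nontrivial (K →L[ℂ] K) :=
  ⟨⟨1, 0, norm_pos_iff.mp h⟩⟩

namespace StronglyConverges

theorem mono {l l' : Filter ι} (h : StronglyConverges l a t) (hl : l' ≤ l) :
    StronglyConverges l' a t := fun p => (h p).mono_left hl

theorem eventually_nontrivial {l : Filter ι} [Nontrivial (H →L[ℂ] H)]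
    (h : StronglyConverges l a t) : ∀ᶠ i in l, Nontrivial (G i →L[ℂ] G i) := by
  filter_upwards [h.tendsto_norm_one.eventually_const_lt
    (norm_pos_iff.mpr (one_ne_zero (α := H →L[ℂ] H)))] with i hi
  exact nontrivial_of_norm_one_pos hi

/-- Limits of points of the matrix ranges of `a i` are adherent to the matrix range of `t`:
a pencil that separates the limit from the matrix range of `t` is, up to a small multiple of the
identity, still positive at `a i`. -/
theorem exists_dist_lt_of_tendsto {l : Filter ι} [l.NeBot] [NeZero n] [Nontrivial (H →L[ℂ] H)]
    (h : StronglyConverges l a t) {X' : ι → MatTuple d n} {X : MatTuple d n}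
    (hX' : ∀ᶠ i in l, X' i ∈ cstarMatrixRange n (a i)) (hX : Tendsto X' l (𝓝 X))
    {ε : ℝ} (hε : 0 < ε) : ∃ Y ∈ cstarMatrixRange n t, dist X Y < ε := by
  by_contra! hfar
  obtain ⟨f, -, hf⟩ := exists_norm_eq_one_re_le_sub (convex_cstarMatrixRange n t)
    (cstarMatrixRange_nonempty t) hε hfar
  obtain ⟨C, hC, hacc⟩ : ∃ C : Matrix (Fin n) (Fin n) ℂ, C.trace.re ≤ (f X).re - ε / 4 ∧
      IsAccretive (scalarMatrix (H →L[ℂ] H) C - pencil (MatTuple.coeff f) t) := by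
    by_contra! hno
    obtain ⟨Y, hY, hr⟩ := exists_le_pairing_re hno
    rw [MatTuple.pairing_coeff] at hr
    have := hf Y hY
    linarith
  have hn : (0 : ℝ) < n := by exact_mod_cast Nat.pos_of_ne_zero (NeZero.ne n)
  have hev := h.eventually_isAccretive hacc (δ := ε / (8 * n)) (by positivity)
  have hle : (f X).re ≤
      (C + ((ε / (8 * n) : ℝ) : ℂ) • (1 : Matrix (Fin n) (Fin n) ℂ)).trace.re := by
    refine le_of_tendsto (((Complex.continuous_re.comp f.continuous).tendsto X).comp hX) ?_
    filter_upwards [hev, hX'] with i hi hXi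
    have := pairing_re_le hi hXi
    rwa [MatTuple.pairing_coeff] at this
  rw [Matrix.trace_add, Matrix.trace_smul, Complex.add_re, smul_eq_mul, Complex.re_ofReal_mul,
    Matrix.trace_one, Fintype.card_fin, Complex.natCast_re,
    show ε / (8 * n) * (n : ℝ) = ε / 8 by field_simp] at hle
  linarith

theorem exists_norm_pencil_coeff_le {l : Filter ι} (h : StronglyConverges l a t) :
    ∃ R : ℝ, ∀ᶠ i in l, ∀ f : StrongDual ℂ (MatTuple d n), ‖f‖ = 1 →
      ‖pencil (MatTuple.coeff f) (a i)‖ ≤ R := by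
  refine ⟨∑ i : Fin n, ∑ j : Fin n, ∑ k, ‖(MatTuple.unitTuple i j k : MatTuple d n)‖ *
    (‖t k‖ + 1), ?_⟩
  have hev : ∀ᶠ i in l, ∀ k, ‖a i k‖ ≤ ‖t k‖ + 1 := by
    rw [eventually_all]
    exact fun k => (h.tendsto_norm k).eventually_le_const (lt_add_one _)
  filter_upwards [hev] with i hi f hf
  refine (CStarMatrix.norm_le_sum _).trans ?_
  refine Finset.sum_le_sum fun p _ => Finset.sum_le_sum fun q _ => ?_
  rw [pencil_apply]
  refine (norm_sum_le _ _).trans (Finset.sum_le_sum fun k _ => ?_)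
  refine (norm_smul_le _ _).trans ?_
  gcongr
  · exact (f.le_opNorm _).trans (by rw [hf, one_mul])
  · exact hi k

/-- Points of the matrix range of `t` are uniformly approximated by the matrix ranges of `a i`:
along an ultrafilter, pencils separating them from the matrix ranges of `a i` would converge to a
pencil that is positive at `t` and contradicts weak duality there. -/
theorem eventually_exists_dist_lt {l : Ultrafilter ι} [NeZero n] [Nontrivial (H →L[ℂ] H)]
    (h : StronglyConverges (l : Filter ι) a t) {X' : ι → MatTuple d n}
    (hX' : ∀ i, X' i ∈ cstarMatrixRange n t) {ε : ℝ} (hε : 0 < ε) :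
    ∀ᶠ i in (l : Filter ι), ∃ Y ∈ cstarMatrixRange n (a i), dist (X' i) Y < ε := by
  by_contra hcon
  rw [Ultrafilter.eventually_not.symm] at hcon
  obtain ⟨X, hX⟩ := l.exists_tendsto_of_norm_le
    (Eventually.of_forall fun i => norm_le_of_mem (hX' i))
  obtain ⟨R, hR⟩ := h.exists_norm_pencil_coeff_le (n := n)
  obtain ⟨R', hR'⟩ : ∃ R' : ℝ, ∀ i, ‖X' i‖ ≤ R' := ⟨_, fun i => norm_le_of_mem (hX' i)⟩
  have hsep : ∀ᶠ i in (l : Filter ι), ∃ (f : StrongDual ℂ (MatTuple d n))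
      (C : Matrix (Fin n) (Fin n) ℂ), ‖f‖ ≤ 1 ∧
      IsAccretive (scalarMatrix _ C - pencil (MatTuple.coeff f) (a i)) ∧
      C.trace.re ≤ (f (X' i)).re - ε / 4 ∧
      ∀ p q, ‖C p q‖ ≤ n * (R' + n * R) + R := by
    filter_upwards [hcon, h.eventually_nontrivial, hR] with i hi hnt hRi
    push Not at hi
    obtain ⟨f, hf1, hf⟩ := exists_norm_eq_one_re_le_sub (convex_cstarMatrixRange n (a i))
      (cstarMatrixRange_nonempty (a i)) hε hi
    obtain ⟨C, hC, hacc⟩ : ∃ C : Matrix (Fin n) (Fin n) ℂ,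
        C.trace.re ≤ (f (X' i)).re - ε / 4 ∧
        IsAccretive (scalarMatrix (G i →L[ℂ] G i) C - pencil (MatTuple.coeff f) (a i)) := by
      by_contra! hno
      obtain ⟨Y, hY, hr⟩ := exists_le_pairing_re hno
      rw [MatTuple.pairing_coeff] at hr
      have := hf Y hY
      linarith
    obtain ⟨D, hD, htr, hDle⟩ := exists_isAccretive_norm_entry_le (hRi f hf1) hacc
    refine ⟨f, D, hf1.le, hD, htr ▸ hC, fun p q => (hDle p q).trans ?_⟩
    have hfX : (f (X' i)).re ≤ R' :=
      (Complex.re_le_norm _).trans ((f.le_opNorm _).trans (by rw [hf1, one_mul]; exact hR' i))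
    gcongr
    linarith
  obtain ⟨f', hf'⟩ := hsep.choice
  obtain ⟨C', hC'⟩ := hf'.choice
  have : ProperSpace (StrongDual ℂ (MatTuple d n)) := FiniteDimensional.proper ℂ _
  obtain ⟨f, hf⟩ := l.exists_tendsto_of_norm_le (hC'.mono fun i hi => hi.1)
  have hCent : ∀ p q, ∃ c, Tendsto (fun i => C' i p q) l (𝓝 c) := fun p q =>
    l.exists_tendsto_of_norm_le (hC'.mono fun i hi => hi.2.2.2 p q)
  choose C hC using hCent
  have happ : ∀ Y : MatTuple d n, Tendsto (fun i => f' i Y) l (𝓝 (f Y)) := fun Y =>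
    ((ContinuousLinearMap.apply ℂ ℂ Y).continuous.tendsto f).comp hf
  have hacc := h.isAccretive_of_tendsto (C := Matrix.of C) (B := MatTuple.coeff f) hC
    (fun k p q => happ _) (hC'.mono fun i hi => hi.2.1)
  have hfX : Tendsto (fun i => f' i (X' i)) l (𝓝 (f X)) :=
    (isBoundedBilinearMap_apply.continuous.tendsto (f, X)).comp (hf.prodMk_nhds hX)
  have htr : Tendsto (fun i => (C' i).trace.re) l (𝓝 (Matrix.of C).trace.re) :=
    (Complex.continuous_re.tendsto _).comp (tendsto_finsetSum _ fun p _ => hC p p)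
  have h1 : (Matrix.of C).trace.re ≤ (f X).re - ε / 4 :=
    le_of_tendsto_of_tendsto htr (((Complex.continuous_re.tendsto _).comp hfX).sub_const _)
      (hC'.mono fun i hi => hi.2.2.1)
  have h2 : (f X).re ≤ (Matrix.of C).trace.re := by
    refine le_of_tendsto ((Complex.continuous_re.tendsto _).comp
      ((f.continuous.tendsto X).comp hX)) (Eventually.of_forall fun i => ?_)
    have := pairing_re_le hacc (hX' i)
    rwa [MatTuple.pairing_coeff] at this
  linarith

theorem tendsto_hausdorffEDist {L : Filter ι} [Nontrivial (H →L[ℂ] H)]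
    (h : StronglyConverges L a t) (n : ℕ) :
    Tendsto (fun i => Metric.hausdorffEDist (cstarMatrixRange n (a i)) (cstarMatrixRange n t)) L
      (𝓝 0) := by
  rcases Nat.eq_zero_or_pos n with rfl | hn
  · simp only [cstarMatrixRange_zero, Metric.hausdorffEDist_self]
    exact tendsto_const_nhds
  have : NeZero n := ⟨hn.ne'⟩
  rw [ENNReal.tendsto_nhds_zero]
  intro ε hε
  obtain ⟨δ, hδ, hδε⟩ : ∃ δ : ℝ, 0 < δ ∧ ENNReal.ofReal δ ≤ ε := by
    obtain ⟨δ, hδ0, hδ⟩ := ENNReal.lt_iff_exists_nnreal_btwn.mp hε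
    exact ⟨δ, by exact_mod_cast hδ0, by rw [ENNReal.ofReal_coe_nnreal]; exact hδ.le⟩
  rw [Filter.eventually_iff, Filter.mem_iff_ultrafilter]
  intro l hl
  have hs := h.mono hl
  have hnear : ∀ {X Y : MatTuple d n} {W : Set (MatTuple d n)}, Y ∈ W → dist X Y < δ →
      Metric.infEDist X W ≤ ENNReal.ofReal δ := fun hY hd =>
    (Metric.infEDist_le_edist_of_mem hY).trans (by
      rw [edist_dist]
      exact ENNReal.ofReal_le_ofReal hd.le)
  have h1 : ∀ᶠ i in (l : Filter ι), ∀ X ∈ cstarMatrixRange n (a i),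
      Metric.infEDist X (cstarMatrixRange n t) ≤ ENNReal.ofReal δ := by
    by_contra hcon
    rw [← Ultrafilter.eventually_not] at hcon
    push Not at hcon
    obtain ⟨X', hX'⟩ := hcon.choice
    have hbd : ∀ᶠ i in (l : Filter ι), ‖X' i‖ ≤ ∑ p : Fin n, ∑ q : Fin n, ∑ k,
        n * (‖t k‖ + 1) * ‖(MatTuple.unitTuple p q k : MatTuple d n)‖ := by
      have hev : ∀ᶠ i in (l : Filter ι), ∀ k, ‖a i k‖ ≤ ‖t k‖ + 1 := by
        rw [eventually_all]
        exact fun k => (hs.tendsto_norm k).eventually_le_const (lt_add_one _)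
      filter_upwards [hX', hev] with i hi hai
      refine (norm_le_of_mem hi.1).trans ?_
      gcongr with p _ q _ k _
      exact hai k
    obtain ⟨X, hX⟩ := l.exists_tendsto_of_norm_le hbd
    obtain ⟨Y, hY, hd⟩ := hs.exists_dist_lt_of_tendsto (hX'.mono fun i hi => hi.1) hX hδ
    obtain ⟨i, hi, hdi⟩ := (hX'.and ((hX.dist tendsto_const_nhds).eventually_lt_const hd)).exists
    exact hi.2.not_ge (hnear hY hdi)
  have h2 : ∀ᶠ i in (l : Filter ι), ∀ X ∈ cstarMatrixRange n t,
      Metric.infEDist X (cstarMatrixRange n (a i)) ≤ ENNReal.ofReal δ := by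
    -- a point of the matrix range of `t` far from that of `a i`, whenever there is one
    obtain ⟨X₀, hX₀⟩ := cstarMatrixRange_nonempty (n := n) t
    have hchoose : ∀ i, ∃ X ∈ cstarMatrixRange n t,
        (∃ Z ∈ cstarMatrixRange n t,
          ENNReal.ofReal δ < Metric.infEDist Z (cstarMatrixRange n (a i))) →
        ENNReal.ofReal δ < Metric.infEDist X (cstarMatrixRange n (a i)) := fun i => by
      by_cases hZ : ∃ Z ∈ cstarMatrixRange n t,
          ENNReal.ofReal δ < Metric.infEDist Z (cstarMatrixRange n (a i))
      · obtain ⟨Z, hZ1, hZ2⟩ := hZ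
        exact ⟨Z, hZ1, fun _ => hZ2⟩
      · exact ⟨X₀, hX₀, fun hZ' => absurd hZ' hZ⟩
    choose X' hX' hfar using hchoose
    filter_upwards [hs.eventually_exists_dist_lt hX' hδ] with i hi Z hZ
    by_contra! hlt
    obtain ⟨Y, hY, hd⟩ := hi
    exact (hfar i ⟨Z, hZ, hlt⟩).not_ge (hnear hY hd)
  change ∀ᶠ i in (l : Filter ι), _
  filter_upwards [h1, h2] with i hi1 hi2
  exact (Metric.hausdorffEDist_le_of_infEDist hi1 hi2).trans hδε

end StronglyConverges

end Hausdorff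

/-! ### Strong convergence from countably many polynomials -/

section Countable

variable {d : ℕ}

/-- A countable ring of `*`-polynomials: those whose coefficients are obtained by sums and products
from a countable dense set of scalars. -/
noncomputable def countablePoly (d : ℕ) : FreeAlgebra ℕ ((Fin d ⊕ Fin d) ⊕ ℕ) →ₐ[ℕ] StarPoly d :=
  FreeAlgebra.lift ℕ (Sum.elim (FreeAlgebra.ι ℂ)
    fun m => algebraMap ℂ (StarPoly d) (TopologicalSpace.denseSeq ℂ m))

theorem countable_freeAlgebra_nat (X : Type) [Countable X] : Countable (FreeAlgebra ℕ X) := by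
  rw [← Cardinal.mk_le_aleph0_iff]
  refine (FreeAlgebra.cardinalMk_le_max ℕ X).trans ?_
  simp

variable {ι : Type*} {G : ι → Type*} [∀ i, NormedAddCommGroup (G i)]
  [∀ i, InnerProductSpace ℂ (G i)] [∀ i, CompleteSpace (G i)]
  {H : Type*} [NormedAddCommGroup H] [InnerProductSpace ℂ H] [CompleteSpace H]
  {a : (i : ι) → Fin d → (G i →L[ℂ] G i)} {t : Fin d → (H →L[ℂ] H)} {l : Filter ι}

theorem StarPoly.norm_eval_algebraMap_le (b : Fin d → (H →L[ℂ] H)) (c : ℂ) :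
    ‖StarPoly.eval b (algebraMap ℂ (StarPoly d) c)‖ ≤ ‖c‖ := by
  rw [StarPoly.eval, AlgHom.commutes, Algebra.algebraMap_eq_smul_one, norm_smul]
  exact mul_le_of_le_one_right (norm_nonneg _) ContinuousLinearMap.norm_id_le

theorem StarPoly.eval_mul (b : Fin d → (H →L[ℂ] H)) (p q : StarPoly d) :
    StarPoly.eval b (p * q) = StarPoly.eval b p * StarPoly.eval b q := map_mul _ p q

theorem StarPoly.eval_add (b : Fin d → (H →L[ℂ] H)) (p q : StarPoly d) :
    StarPoly.eval b (p + q) = StarPoly.eval b p + StarPoly.eval b q := map_add _ p q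

theorem StarPoly.eval_sub (b : Fin d → (H →L[ℂ] H)) (p q : StarPoly d) :
    StarPoly.eval b (p - q) = StarPoly.eval b p - StarPoly.eval b q := map_sub _ p q

/-- Products of approximated polynomials are approximated; `r` only serves to bound `p₂`. -/
theorem norm_eval_mul_sub_le {p₁ p₂ q₁ q₂ r : StarPoly d} {ε M M₁ : ℝ} (hM0 : 0 ≤ M)
    (hM₁0 : 0 < M₁) (b : Fin d → (H →L[ℂ] H)) (h₁ : ‖StarPoly.eval b (p₂ - r)‖ ≤ 1)
    (h₂ : ‖StarPoly.eval b r‖ ≤ M) (h₃ : ‖StarPoly.eval b (p₁ - q₁)‖ ≤ ε / (2 * (M + 1)))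
    (h₄ : ‖StarPoly.eval b q₁‖ ≤ M₁) (h₅ : ‖StarPoly.eval b (p₂ - q₂)‖ ≤ ε / (2 * M₁)) :
    ‖StarPoly.eval b (p₁ * p₂ - q₁ * q₂)‖ ≤ ε := by
  have h₆ : ‖StarPoly.eval b p₂‖ ≤ M + 1 := by
    rw [← sub_add_cancel p₂ r, StarPoly.eval_add]
    exact (norm_add_le _ _).trans (by linarith)
  have h₇ : p₁ * p₂ - q₁ * q₂ = (p₁ - q₁) * p₂ + q₁ * (p₂ - q₂) := by noncomm_ring
  rw [h₇, StarPoly.eval_add, StarPoly.eval_mul, StarPoly.eval_mul]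
  calc _ ≤ ε / (2 * (M + 1)) * (M + 1) + M₁ * (ε / (2 * M₁)) := by
        refine (norm_add_le _ _).trans (add_le_add ?_ ?_)
        · exact (norm_mul_le _ _).trans
            (mul_le_mul h₃ h₆ (norm_nonneg _) ((norm_nonneg _).trans h₃))
        · exact (norm_mul_le _ _).trans (mul_le_mul h₄ h₅ (norm_nonneg _) hM₁0.le)
    _ = ε := by field_simp; ring

theorem exists_countablePoly_approx
    (h : ∀ q, Tendsto (fun i => ‖StarPoly.eval (a i) (countablePoly d q)‖) l
      (𝓝 ‖StarPoly.eval t (countablePoly d q)‖)) (p : StarPoly d) :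
    ∀ ε : ℝ, 0 < ε → ∃ q, (∀ᶠ i in l, ‖StarPoly.eval (a i) (p - countablePoly d q)‖ ≤ ε) ∧
      ‖StarPoly.eval t (p - countablePoly d q)‖ ≤ ε := by
  have hbd : ∀ q, ∃ M : ℝ, 0 < M ∧ (∀ᶠ i in l, ‖StarPoly.eval (a i) (countablePoly d q)‖ ≤ M) ∧
      ‖StarPoly.eval t (countablePoly d q)‖ ≤ M := fun q =>
    ⟨‖StarPoly.eval t (countablePoly d q)‖ + 1, by positivity,
      (h q).eventually_le_const (lt_add_one _), (lt_add_one _).le⟩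
  induction p using FreeAlgebra.induction with
  | grade0 c =>
    intro ε hε
    obtain ⟨m, hm⟩ := (TopologicalSpace.denseRange_denseSeq ℂ).exists_dist_lt c hε
    have hq : countablePoly d (FreeAlgebra.ι ℕ (Sum.inr m)) =
        algebraMap ℂ (StarPoly d) (TopologicalSpace.denseSeq ℂ m) := by
      simp [countablePoly]
    refine ⟨FreeAlgebra.ι ℕ (Sum.inr m), ?_⟩
    rw [hq, ← map_sub]
    rw [dist_eq_norm] at hm
    exact ⟨Eventually.of_forall fun i => (StarPoly.norm_eval_algebraMap_le _ _).trans hm.le,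
      (StarPoly.norm_eval_algebraMap_le _ _).trans hm.le⟩
  | grade1 x =>
    intro ε hε
    have hq : countablePoly d (FreeAlgebra.ι ℕ (Sum.inl x)) = FreeAlgebra.ι ℂ x := by
      simp [countablePoly]
    refine ⟨FreeAlgebra.ι ℕ (Sum.inl x), ?_⟩
    rw [hq, sub_self]
    simp [StarPoly.eval, hε.le]
  | add p₁ p₂ ih₁ ih₂ =>
    intro ε hε
    obtain ⟨q₁, h₁, h₁'⟩ := ih₁ (ε / 2) (half_pos hε)
    obtain ⟨q₂, h₂, h₂'⟩ := ih₂ (ε / 2) (half_pos hε)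
    refine ⟨q₁ + q₂, ?_⟩
    rw [map_add, add_sub_add_comm]
    simp only [StarPoly.eval_add]
    refine ⟨?_, (norm_add_le _ _).trans (by linarith)⟩
    filter_upwards [h₁, h₂] with i hi₁ hi₂
    exact (norm_add_le _ _).trans (by linarith)
  | mul p₁ p₂ ih₁ ih₂ =>
    intro ε hε
    obtain ⟨r, hr, hr'⟩ := ih₂ 1 one_pos
    obtain ⟨M, hM0, hM, hM'⟩ := hbd r
    obtain ⟨q₁, h₁, h₁'⟩ := ih₁ (ε / (2 * (M + 1))) (by positivity)
    obtain ⟨M₁, hM₁0, hM₁, hM₁'⟩ := hbd q₁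
    obtain ⟨q₂, h₂, h₂'⟩ := ih₂ (ε / (2 * M₁)) (by positivity)
    refine ⟨q₁ * q₂, ?_⟩
    rw [map_mul]
    refine ⟨?_, norm_eval_mul_sub_le hM0.le hM₁0 t hr' hM' h₁' hM₁' h₂'⟩
    filter_upwards [hr, hM, h₁, hM₁, h₂] with i k1 k2 k3 k4 k5
    exact norm_eval_mul_sub_le hM0.le hM₁0 (a i) k1 k2 k3 k4 k5

theorem stronglyConverges_of_countablePoly
    (h : ∀ q, Tendsto (fun i => ‖StarPoly.eval (a i) (countablePoly d q)‖) l
      (𝓝 ‖StarPoly.eval t (countablePoly d q)‖)) : StronglyConverges l a t := by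
  intro p
  rw [Metric.tendsto_nhds]
  intro ε hε
  obtain ⟨q, hq, hq'⟩ := exists_countablePoly_approx h p (ε / 4) (by positivity)
  filter_upwards [hq, Metric.tendsto_nhds.mp (h q) (ε / 4) (by positivity)] with i hi hi'
  rw [StarPoly.eval_sub] at hi hq'
  rw [Real.dist_eq, abs_lt] at hi' ⊢
  have h1 := abs_le.mp ((abs_norm_sub_norm_le _ _).trans hi)
  have h2 := abs_le.mp ((abs_norm_sub_norm_le _ _).trans hq')
  constructor <;> linarith [h1.1, h1.2, h2.1, h2.2, hi'.1, hi'.2]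

end Countable

/-! ### Almost sure convergence of matrix ranges -/

theorem mainTheorem5 {Ω : Type*} [MeasurableSpace Ω] (P : Measure Ω) [IsProbabilityMeasure P]
    {H : Type*} [NormedAddCommGroup H] [InnerProductSpace ℂ H] [CompleteSpace H]
    (d : ℕ)
    (T : (N : ℕ) → Ω → Fin d → Matrix (Fin N) (Fin N) ℂ)
    (hmeas : ∀ (N : ℕ) (k : Fin d) (i j : Fin N), Measurable fun ω => T N ω k i j)
    (t : Fin d → (H →L[ℂ] H))
    (hT : ∀ p : StarPoly d, ∀ᵐ ω ∂P,
      Tendsto (fun N => ‖StarPoly.eval (tupleOp (T N ω)) p‖) atTop (𝓝 ‖StarPoly.eval t p‖)) :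
    ∀ᵐ ω ∂P, ∀ n : ℕ,
      Tendsto (fun N => Metric.hausdorffEDist (matrixRange n (tupleOp (T N ω))) (matrixRange n t))
        atTop (𝓝 0) := by
  have := countable_freeAlgebra_nat ((Fin d ⊕ Fin d) ⊕ ℕ)
  filter_upwards [ae_all_iff.mpr fun q => hT (countablePoly d q)] with ω hω n
  have hs : StronglyConverges atTop (fun N => tupleOp (T N ω)) t :=
    stronglyConverges_of_countablePoly hω
  -- the norms of `1` converge, so the limit space is not trivial
  have h1 : ∀ᶠ N in atTop, ‖(1 : EuclideanSpace ℂ (Fin N) →L[ℂ] EuclideanSpace ℂ (Fin N))‖ = 1 := by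
    filter_upwards [eventually_gt_atTop 0] with N hN
    have : NeZero N := ⟨hN.ne'⟩
    exact norm_one
  have h2 : ‖(1 : H →L[ℂ] H)‖ = 1 :=
    tendsto_nhds_unique (hs.tendsto_norm_one.congr' h1) tendsto_const_nhds
  have : Nontrivial (H →L[ℂ] H) := nontrivial_of_norm_one_pos (h2 ▸ one_pos)
  simp only [matrixRange_eq]
  exact hs.tendsto_hausdorffEDist n
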